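/- Setting. Let $d\ge 1$, $\Omega=(0,1)^d$, and let $f\in L^\infty(\Omega)$ with $\int_\Omega f\,dx=0$ and $\overline{\mathrm{co}}(\operatorname{supp} f)\subset\Omega$. Let $(\mathcal T^n)_{n\in\mathbb N}$, $\mathcal T^n=\{T^n_1,\dots,T^n_{N_n}\}$, be a nested sequence of conforming simplicial triangulations of $\overline\Omega$ (each $\mathcal T^{n+1}$ refines $\mathcal T^n$; for instance one obtained by uniform refinements), and let $\delta_m>0$ be a monotone sequence with $\delta_m\downarrow 0$. Let $\mathcal W_n$ be the space of functions $u$ that are continuous on $\overline\Omega$, affine on every simplex of $\mathcal T^{n+1}$, and satisfy $\int_\Omega u\,dx=0$. Fix $n$, write $N=N_n$ and $\mathbb R^N_+=\{\boldsymbol\mu\in\mathbb R^N:\mu_i\ge 0\ \forall i\}$, and for $\boldsymbol\mu\in\mathbb R^N$ put $\mathcal I_n(\boldsymbol\mu)=\sum_{i=1}^N\mu_i\chi_{T^n_i}$. Define $E_n:\mathbb R^N\to\mathbb R\cup\{+\infty\}$ by $$E_n(\boldsymbol\mu)=\sup_{u\in\mathcal W_n}\Big(2\int_\Omega fu\,dx-\int_\Omega(\mathcal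 I_n(\boldsymbol\mu)+\delta_n)|\nabla u|^2dx\Big)+\int_\Omega \mathcal I_n(\boldsymbol\mu)\,dx\quad\text{if }\boldsymbol\mu\in\mathbb R^N_+,$$ and $E_n(\boldsymbol\mu)=+\infty$ otherwise. Let $\partial^\circ E_n(\boldsymbol\mu)$ be the element of minimal Euclidean norm of the convex subdifferential of $E_n$ at $\boldsymbol\mu$. Let $\boldsymbol\mu^0\in\mathbb R^N_+$. An admissible curve is a locally absolutely continuous, a.e. differentiable curve $\boldsymbol\mu:[0,\infty)\to\mathbb R^N_+$ with $\boldsymbol\mu(0)=\boldsymbol\mu^0$. It is called an energy solution of the flow $\boldsymbol\mu'=-\partial^\circ E_n(\boldsymbol\mu)$ if $\|\boldsymbol\mu'(t)\|=\|\partial^\circ E_n(\boldsymbol\mu(t))\|$ for a.e. $t>0$ and, for all $t\ge 0$, the function $\|\partial^\circ E_n(\boldsymbol\mu(\cdot))\|^2$ is integrable on $[0,t]$ and the energy identity $$E_n(\boldsymbol\mu(t))=E_n(\boldsymbol\mu^0)-\int_0^t\|\partial^\circ E_n(\boldsymbol\mu(s))\|^2\,ds$$ holds. Theorem. For every $\boldsymbol\mu^0\in\mathbb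 R^N_+$ with $\partial^\circ E_n(\boldsymbol\mu^0)\ne 0$ there is a unique energy solution $\boldsymbol\mu$ of the flow. It satisfies $\boldsymbol\mu'(t)=-\partial^\circ E_n(\boldsymbol\mu(t))$ for almost every $t>0$, and it is also the only admissible curve that does so. Moreover, $\lim_{t\to+\infty}\boldsymbol\mu(t)$ exists and is a minimizer of $E_n$ over $\mathbb R^N_+$. -/

import Mathlib

open MeasureTheory Set Filter Topology

noncomputable section

namespace TransportFEM

/-- Euclidean space `ℝ^d`. -/
abbrev Eucl (d : ℕ) : Type := EuclideanSpace ℝ (Fin d)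

/-- The open unit cube `Ω = (0,1)^d`. -/
def unitCube (d : ℕ) : Set (Eucl d) := {x | ∀ k, 0 < x k ∧ x k < 1}

/-- A (conforming, simplicial) triangulation of the cube `Ω` with `N` cells. The cells are the
closed nondegenerate `d`-simplices spanned by the given vertices, they cover the closure of `Ω`, and
two different cells meet exactly in the face (possibly empty) spanned by their common vertices. -/
structure Triangulation (d N : ℕ) where
  vertex : Fin N → Fin (d + 1) → Eucl d
  affineIndependent : ∀ j, AffineIndependent ℝ (vertex j)
  cover : ⋃ j, convexHull ℝ (range (vertex j)) = closure (unitCube d)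
  conforming : ∀ i j, i ≠ j →
    convexHull ℝ (range (vertex i)) ∩ convexHull ℝ (range (vertex j)) =
      convexHull ℝ (range (vertex i) ∩ range (vertex j))
  distinct : ∀ i j, i ≠ j → range (vertex i) ≠ range (vertex j)

namespace Triangulation

variable {d N M : ℕ}

/-- The `j`-th closed cell `T_j`. -/
def cell (T : Triangulation d N) (j : Fin N) : Set (Eucl d) :=
  convexHull ℝ (range (T.vertex j))

/-- `T'` is a refinement of `T`: every cell of `T'` lies in a cell of `T`. -/
def IsRefinement (T : Triangulation d N) (T' : Triangulation d M) : Prop :=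
  ∀ i : Fin M, ∃ j : Fin N, T'.cell i ⊆ T.cell j

/-- `P₁(T)`: functions that are continuous on the closed cube and affine on each cell.
(Only the values on the closed cube matter.) -/
def P1 (T : Triangulation d N) : Set (Eucl d → ℝ) :=
  {u | ContinuousOn u (closure (unitCube d)) ∧
    ∀ j, ∃ a : Eucl d →ᵃ[ℝ] ℝ, EqOn u a (T.cell j)}

/-- The functions in `P₁(T)` with zero mean on `Ω`. -/
def meanZeroP1 (T : Triangulation d N) : Set (Eucl d → ℝ) :=
  {u | u ∈ T.P1 ∧ ∫ x in unitCube d, u x = 0}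

/-- The map `𝓘` from coordinates to piecewise constant functions,
`𝓘(μ) = ∑ i, μ i • 1_{T_i}` (well defined up to the null set of the cell boundaries). -/
def pwConst (T : Triangulation d N) (μ : EuclideanSpace ℝ (Fin N)) : Eucl d → ℝ :=
  fun x => ∑ i, μ i * (T.cell i).indicator (fun _ => (1 : ℝ)) x

end Triangulation

/-- The essential support in `Ω` of `f` (the complement of the largest open set on which
`f = 0` almost everywhere in `Ω`). -/
def essSupport {d : ℕ} (f : Eucl d → ℝ) : Set (Eucl d) :=
  {x | ∀ U ∈ 𝓝 x, ¬ (∀ᵐ y ∂(volume.restrict (U ∩ unitCube d)), f y = 0)}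

/-- `𝓓_δ(ρ,u) = 2 ∫_Ω f u dx - ∫_Ω (ρ + δ) |∇u|² dx`. -/
def dualFunctional {d : ℕ} (f : Eucl d → ℝ) (δ : ℝ) (ρ u : Eucl d → ℝ) : ℝ :=
  2 * (∫ x in unitCube d, f x * u x) - ∫ x in unitCube d, (ρ x + δ) * ‖gradient u x‖ ^ 2

/-- The closed nonnegative orthant `ℝ^N_+`. -/
def orthant (N : ℕ) : Set (EuclideanSpace ℝ (Fin N)) := {μ | ∀ i, 0 ≤ μ i}

open Classical in
/-- The discrete transport energy in coordinates: densities are piecewise constant on `T`,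
potentials are continuous, piecewise affine on `T'` and of zero mean. Its value at `μ` is
`sup_u 𝓓_δ(𝓘 μ, u) + ∫_Ω 𝓘 μ dx` on the nonnegative orthant, and `+∞` elsewhere. -/
def energy {d N M : ℕ} (f : Eucl d → ℝ) (δ : ℝ) (T : Triangulation d N)
    (T' : Triangulation d M) (μ : EuclideanSpace ℝ (Fin N)) : EReal :=
  if μ ∈ orthant N then
    (⨆ u ∈ T'.meanZeroP1, ((dualFunctional f δ (T.pwConst μ) u : ℝ) : EReal)) +
      ((∫ x in unitCube d, T.pwConst μ x : ℝ) : EReal)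
  else ⊤

section Subdifferential

variable {V : Type*} [NormedAddCommGroup V] [InnerProductSpace ℝ V]

/-- The convex subdifferential `∂Φ(x)` of an extended real valued function. -/
def subdifferential (Φ : V → EReal) (x : V) : Set V :=
  {ξ | Φ x ≠ ⊤ ∧ ∀ y, Φ x + ((inner ℝ ξ (y - x) : ℝ) : EReal) ≤ Φ y}

/-- `ξ` is an element of minimal norm of `∂Φ(x)`. -/
def IsMinimalSubgradient (Φ : V → EReal) (x ξ : V) : Prop :=
  ξ ∈ subdifferential Φ x ∧ ∀ η ∈ subdifferential Φ x, ‖ξ‖ ≤ ‖η‖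

/-- There is at most one subgradient of minimal norm. -/
theorem IsMinimalSubgradient.unique {Φ : V → EReal} {x ξ η : V}
    (h : IsMinimalSubgradient Φ x ξ) (h' : IsMinimalSubgradient Φ x η) : ξ = η := by
  have hn : ‖ξ‖ = ‖η‖ := le_antisymm (h.2 _ h'.1) (h'.2 _ h.1)
  have hm : (1 / 2 : ℝ) • (ξ + η) ∈ subdifferential Φ x := by
    refine ⟨h.1.1, fun y => ?_⟩
    have e : inner ℝ ((1 / 2 : ℝ) • (ξ + η)) (y - x) =
        (1 / 2 : ℝ) * (inner ℝ ξ (y - x) + inner ℝ η (y - x)) := by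
      rw [real_inner_smul_left, inner_add_left]
    rcases le_total (inner ℝ ξ (y - x)) (inner ℝ η (y - x)) with hle | hle
    · refine le_trans ?_ (h'.1.2 y)
      gcongr
      rw [e]; linarith
    · refine le_trans ?_ (h.1.2 y)
      gcongr
      rw [e]; linarith
  have h1 := h.2 _ hm
  have h2 : ‖(1 / 2 : ℝ) • (ξ + η)‖ = 1 / 2 * ‖ξ + η‖ := by
    rw [norm_smul]; norm_num
  have h3 := parallelogram_law_with_norm ℝ ξ η
  have h4 : 0 ≤ ‖ξ‖ := norm_nonneg _
  have h5 : ‖ξ - η‖ * ‖ξ - η‖ ≤ 0 := by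
    rw [← hn] at h3
    nlinarith
  have h6 : ‖ξ - η‖ = 0 := mul_self_eq_zero.mp (le_antisymm h5 (mul_self_nonneg _))
  exact sub_eq_zero.mp (norm_eq_zero.mp h6)

open Classical in
/-- `∂°Φ(x)`, the element of minimal norm of the subdifferential (`0` where there is none). -/
def minimalSubgradient (Φ : V → EReal) (x : V) : V :=
  if h : ∃ ξ, IsMinimalSubgradient Φ x ξ then h.choose else 0

end Subdifferential

section Flow

variable {N : ℕ}

/-- Locally absolutely continuous, a.e. differentiable curves `[0,∞) → ℝ^N_+` starting at `μ₀`
(the values of `γ` at negative times are irrelevant). -/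
structure IsAdmissibleCurve (μ₀ : EuclideanSpace ℝ (Fin N))
    (γ : ℝ → EuclideanSpace ℝ (Fin N)) : Prop where
  init : γ 0 = μ₀
  mem_orthant : ∀ t, 0 ≤ t → γ t ∈ orthant N
  locallyAC : ∀ t, 0 ≤ t → AbsolutelyContinuousOnInterval γ 0 t
  ae_differentiable : ∀ᵐ t ∂(volume.restrict (Ioi (0 : ℝ))), DifferentiableAt ℝ γ t

/-- The energy identity `Φ(γ(t)) = Φ(γ(0)) - ∫₀ᵗ ‖∂°Φ(γ(s))‖² ds`. -/
def EnergyIdentity (Φ : EuclideanSpace ℝ (Fin N) → EReal)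
    (γ : ℝ → EuclideanSpace ℝ (Fin N)) : Prop :=
  ∀ t, 0 ≤ t →
    IntervalIntegrable (fun s => ‖minimalSubgradient Φ (γ s)‖ ^ 2) volume 0 t ∧
    Φ (γ t) = Φ (γ 0) - ((∫ s in (0 : ℝ)..t, ‖minimalSubgradient Φ (γ s)‖ ^ 2 : ℝ) : EReal)

/-- Energy solutions (curves of maximal slope) of `γ' = -∂°Φ(γ)`, `γ(0) = μ₀`: the energy
identity holds and the speed is `‖γ'(t)‖ = ‖∂°Φ(γ(t))‖` for almost every `t`. -/
structure IsEnergySolution (Φ : EuclideanSpace ℝ (Fin N) → EReal)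
    (μ₀ : EuclideanSpace ℝ (Fin N)) (γ : ℝ → EuclideanSpace ℝ (Fin N)) : Prop where
  admissible : IsAdmissibleCurve μ₀ γ
  energyIdentity : EnergyIdentity Φ γ
  speed : ∀ᵐ t ∂(volume.restrict (Ioi (0 : ℝ))),
    ‖deriv γ t‖ = ‖minimalSubgradient Φ (γ t)‖

/-- The differential equation `γ'(t) = -∂°Φ(γ(t))` holds for almost every `t > 0`. -/
def SolvesFlowAE (Φ : EuclideanSpace ℝ (Fin N) → EReal)
    (γ : ℝ → EuclideanSpace ℝ (Fin N)) : Prop :=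
  ∀ᵐ t ∂(volume.restrict (Ioi (0 : ℝ))), HasDerivAt γ (-minimalSubgradient Φ (γ t)) t

end Flow

end TransportFEM

end

noncomputable section

namespace TransportFEM

/-! The energy is a convex function with domain the orthant whose subgradients have a Lipschitz
selection `g`, so the flow is an ordinary differential equation reflected at the coordinate
hyperplanes.

Structure of the energy. A potential enters only through its vector of cell gradients. Continuous
piecewise affine functions with vanishing gradients are constant and `f` has mean zero, so the load
factors through these vectors. Since `δ > 0`, the remaining quadratic form is coercive, the supremum
is attained at a Lax–Milgram solution `u μ`, and `g μ i = m i - a i (u μ) (u μ)` is the envelope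
gradient (`exists_isOrthantPotential_of_quadratic`, `exists_isOrthantPotential_energy`).

Existence. The minimal subgradient is `g` with its positive entries removed where `μ i = 0`
(`isMinimalSubgradient`). The Skorokhod reflection of a path adds to each coordinate the least
nondecreasing term keeping it nonnegative. Picard iteration in an exponentially weighted sup norm
solves the reflected integral equation (`exists_reflected_path`), and differentiating the solution
gives the flow (`exists_solution`).

Equivalence, uniqueness, limit. The chain rule `deriv_comp_eq` turns the flow into the energy
identity; conversely, identity and speed condition force equality in Cauchy–Schwarz. Monotonicity of
the subdifferential makes two solutions approach each other. The distance to every minimizer is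
nonincreasing and the energy tends to its minimum, so a cluster point of the bounded orbit is its
limit. -/

/-- `Φ` is a convex function with domain the orthant that is finite there, equal to `e`, with a
bounded Lipschitz selection `g` of subgradients, and coercive. -/
structure IsOrthantPotential {N : ℕ} (Φ : EuclideanSpace ℝ (Fin N) → EReal)
    (e : EuclideanSpace ℝ (Fin N) → ℝ)
    (g : EuclideanSpace ℝ (Fin N) → EuclideanSpace ℝ (Fin N)) : Prop where
  eq_coe : ∀ μ ∈ orthant N, Φ μ = (e μ : EReal)
  eq_top : ∀ μ, μ ∉ orthant N → Φ μ = ⊤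
  le_of_mem : ∀ μ ∈ orthant N, ∀ ν ∈ orthant N, e μ + inner ℝ (g μ) (ν - μ) ≤ e ν
  bounded : ∃ C, 0 ≤ C ∧ ∀ μ ∈ orthant N, ‖g μ‖ ≤ C
  lipschitz : ∃ L, 0 ≤ L ∧ ∀ μ ∈ orthant N, ∀ ν ∈ orthant N, ‖g μ - g ν‖ ≤ L * ‖μ - ν‖
  coercive : ∃ c, 0 < c ∧ ∀ μ ∈ orthant N, ∀ i, c * μ i ≤ e μ

/-- The projection of `v` onto (minus) the tangent cone of the orthant at `μ`. -/
def projTangent {N : ℕ} (μ v : EuclideanSpace ℝ (Fin N)) : EuclideanSpace ℝ (Fin N) :=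
  WithLp.toLp 2 fun i => if 0 < μ i then v i else min (v i) 0

@[simp]
theorem projTangent_apply {N : ℕ} (μ v : EuclideanSpace ℝ (Fin N)) (i : Fin N) :
    projTangent μ v i = if 0 < μ i then v i else min (v i) 0 := rfl

theorem inner_eq_sum {N : ℕ} (x y : EuclideanSpace ℝ (Fin N)) :
    inner ℝ x y = ∑ i, x i * y i := by
  simp [PiLp.inner_apply, mul_comm]

theorem isClosed_orthant (N : ℕ) : IsClosed (orthant N) := by
  have : orthant N = ⋂ i, {μ | 0 ≤ μ i} := by ext; simp [orthant]
  rw [this]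
  exact isClosed_iInter fun i => isClosed_le continuous_const (by fun_prop)

/-! ### Convex analysis on the orthant: minimal subgradients and minimizers. -/

namespace IsOrthantPotential

variable {N : ℕ} {Φ : EuclideanSpace ℝ (Fin N) → EReal} {e : EuclideanSpace ℝ (Fin N) → ℝ}
  {g : EuclideanSpace ℝ (Fin N) → EuclideanSpace ℝ (Fin N)}

theorem mem_subdifferential_iff (h : IsOrthantPotential Φ e g) {μ : EuclideanSpace ℝ (Fin N)}
    (hμ : μ ∈ orthant N) (ξ : EuclideanSpace ℝ (Fin N)) :
    ξ ∈ subdifferential Φ μ ↔ ∀ ν ∈ orthant N, e μ + inner ℝ ξ (ν - μ) ≤ e ν := by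
  constructor
  · rintro ⟨-, h2⟩ ν hν
    have := h2 ν
    rw [h.eq_coe μ hμ, h.eq_coe ν hν] at this
    exact_mod_cast this
  · intro h2
    refine ⟨by simp [h.eq_coe μ hμ], fun ν => ?_⟩
    by_cases hν : ν ∈ orthant N
    · rw [h.eq_coe μ hμ, h.eq_coe ν hν]
      exact_mod_cast h2 ν hν
    · rw [h.eq_top ν hν]; exact le_top

/-- Where `μ i = 0`, every competitor has `ν i - μ i ≥ 0`, so lowering that entry of `g μ` only
weakens the subgradient inequality. -/
theorem projTangent_mem_subdifferential (h : IsOrthantPotential Φ e g)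
    {μ : EuclideanSpace ℝ (Fin N)} (hμ : μ ∈ orthant N) :
    projTangent μ (g μ) ∈ subdifferential Φ μ := by
  rw [h.mem_subdifferential_iff hμ]
  intro ν hν
  refine le_trans ?_ (h.le_of_mem μ hμ ν hν)
  rw [inner_eq_sum, inner_eq_sum, add_le_add_iff_left]
  refine Finset.sum_le_sum fun i _ => ?_
  simp only [projTangent_apply, PiLp.sub_apply]
  split_ifs with hi
  · rfl
  · have h0 : μ i = 0 := le_antisymm (not_lt.1 hi) (hμ i)
    rw [h0, sub_zero]
    exact mul_le_mul_of_nonneg_right (min_le_left _ _) (hν i)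

/-- Directional comparison: a subgradient is dominated by `g` in every feasible direction. -/
theorem inner_le_of_mem_subdifferential (h : IsOrthantPotential Φ e g)
    {μ ξ v : EuclideanSpace ℝ (Fin N)} (hμ : μ ∈ orthant N) (hξ : ξ ∈ subdifferential Φ μ)
    {r : ℝ} (hr : 0 < r) (hv : ∀ t, 0 < t → t ≤ r → μ + t • v ∈ orthant N) :
    inner ℝ ξ v ≤ inner ℝ (g μ) v := by
  rw [h.mem_subdifferential_iff hμ] at hξ
  obtain ⟨L, hL, hg⟩ := h.lipschitz
  -- Compare the subgradient inequality for `ξ` at `μ` with that for `g` at `μ + t • v`, and divide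
  -- by `t`. The Lipschitz bound on `g` costs `O(t)`, which vanishes as `t → 0`.
  have key : ∀ t, 0 < t → t ≤ r → inner ℝ ξ v ≤ inner ℝ (g μ) v + t * (L * ‖v‖ * ‖v‖) := by
    intro t ht htr
    have h1 := hξ _ (hv t ht htr)
    have h2 := h.le_of_mem _ (hv t ht htr) μ hμ
    rw [add_sub_cancel_left, inner_smul_right] at h1
    rw [sub_add_cancel_left, inner_neg_right, inner_smul_right] at h2
    have h3 : inner ℝ ξ v ≤ inner ℝ (g (μ + t • v)) v := by
      have : t * inner ℝ ξ v ≤ t * inner ℝ (g (μ + t • v)) v := by linarith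
      exact le_of_mul_le_mul_left this ht
    have h4 : inner ℝ (g (μ + t • v) - g μ) v ≤ t * (L * ‖v‖ * ‖v‖) := by
      refine (real_inner_le_norm _ _).trans ?_
      have := hg _ (hv t ht htr) μ hμ
      rw [add_sub_cancel_left, norm_smul, Real.norm_of_nonneg ht.le] at this
      calc _ ≤ L * (t * ‖v‖) * ‖v‖ := by gcongr
        _ = _ := by ring
    rw [inner_sub_left] at h4
    linarith
  have hlim : Tendsto (fun t : ℝ => inner ℝ (g μ) v + t * (L * ‖v‖ * ‖v‖)) (𝓝[>] 0)
      (𝓝 (inner ℝ (g μ) v)) := by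
    have : Tendsto (fun t : ℝ => inner ℝ (g μ) v + t * (L * ‖v‖ * ‖v‖)) (𝓝 0)
        (𝓝 (inner ℝ (g μ) v + 0 * (L * ‖v‖ * ‖v‖))) :=
      (Continuous.tendsto (by fun_prop) 0)
    rw [zero_mul, add_zero] at this
    exact this.mono_left nhdsWithin_le_nhds
  refine ge_of_tendsto hlim ?_
  filter_upwards [Ioc_mem_nhdsGT hr] with t ht using key t ht.1 ht.2

/-- The direction `e_i` is always feasible and `-e_i` is feasible up to length `μ i`. Hence a
subgradient has entries at most those of `g μ`, with equality where `μ i > 0`, and the norm can be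
minimized coordinate by coordinate. -/
theorem isMinimalSubgradient (h : IsOrthantPotential Φ e g)
    {μ : EuclideanSpace ℝ (Fin N)} (hμ : μ ∈ orthant N) :
    IsMinimalSubgradient Φ μ (projTangent μ (g μ)) := by
  refine ⟨h.projTangent_mem_subdifferential hμ, fun ξ hξ => ?_⟩
  have h1 : ∀ i, ξ i ≤ g μ i := by
    intro i
    have := h.inner_le_of_mem_subdifferential (v := EuclideanSpace.single i 1) hμ hξ one_pos
      (fun t ht _ j => by
        have := hμ j
        simp only [PiLp.add_apply, PiLp.smul_apply, PiLp.single_apply, smul_eq_mul]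
        split_ifs <;> simp <;> linarith)
    simpa [EuclideanSpace.inner_single_right] using this
  have h2 : ∀ i, 0 < μ i → g μ i ≤ ξ i := by
    intro i hi
    have := h.inner_le_of_mem_subdifferential (v := -EuclideanSpace.single i 1) hμ hξ hi
      (fun t ht htr j => by
        have := hμ j
        simp only [PiLp.add_apply, PiLp.smul_apply, PiLp.neg_apply, PiLp.single_apply,
          smul_eq_mul]
        split_ifs with hj
        · subst hj; linarith
        · simpa using this)
    simpa [EuclideanSpace.inner_single_right] using this
  rw [EuclideanSpace.norm_eq, EuclideanSpace.norm_eq]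
  apply Real.sqrt_le_sqrt
  gcongr with i
  simp only [projTangent_apply]
  split_ifs with hi
  · rw [le_antisymm (h1 i) (h2 i hi)]
  · rcases le_total (g μ i) 0 with h0 | h0
    · rw [min_eq_left h0, Real.norm_of_nonpos h0, Real.norm_of_nonpos ((h1 i).trans h0)]
      linarith [h1 i]
    · rw [min_eq_right h0, norm_zero]; exact norm_nonneg _

theorem minimalSubgradient_eq (h : IsOrthantPotential Φ e g)
    {μ : EuclideanSpace ℝ (Fin N)} (hμ : μ ∈ orthant N) :
    minimalSubgradient Φ μ = projTangent μ (g μ) := by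
  have hex : ∃ ξ, IsMinimalSubgradient Φ μ ξ := ⟨_, h.isMinimalSubgradient hμ⟩
  rw [minimalSubgradient, dif_pos hex]
  exact hex.choose_spec.unique (h.isMinimalSubgradient hμ)

theorem le_of_minimalSubgradient (h : IsOrthantPotential Φ e g)
    {μ ν : EuclideanSpace ℝ (Fin N)} (hμ : μ ∈ orthant N) (hν : ν ∈ orthant N) :
    e μ + inner ℝ (minimalSubgradient Φ μ) (ν - μ) ≤ e ν := by
  rw [h.minimalSubgradient_eq hμ]
  exact (h.mem_subdifferential_iff hμ _).1 (h.projTangent_mem_subdifferential hμ) ν hν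

theorem exists_lipschitz (h : IsOrthantPotential Φ e g) :
    ∃ C, 0 ≤ C ∧ ∀ μ ∈ orthant N, ∀ ν ∈ orthant N, |e μ - e ν| ≤ C * ‖μ - ν‖ := by
  obtain ⟨C, hC, hb⟩ := h.bounded
  have key : ∀ μ ∈ orthant N, ∀ ν ∈ orthant N, e μ - e ν ≤ C * ‖μ - ν‖ := by
    intro μ hμ ν hν
    have h1 := h.le_of_mem μ hμ ν hν
    have h2 : -inner ℝ (g μ) (ν - μ) ≤ C * ‖μ - ν‖ := by
      rw [← inner_neg_right, neg_sub]
      exact (real_inner_le_norm _ _).trans (by gcongr; exact hb μ hμ)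
    linarith
  refine ⟨C, hC, fun μ hμ ν hν => abs_le.2 ⟨?_, key μ hμ ν hν⟩⟩
  have := key ν hν μ hμ
  rw [norm_sub_rev] at this
  linarith

theorem continuousOn (h : IsOrthantPotential Φ e g) : ContinuousOn e (orthant N) := by
  obtain ⟨C, hC, hl⟩ := h.exists_lipschitz
  have : LipschitzOnWith ⟨C, hC⟩ e (orthant N) :=
    LipschitzOnWith.of_dist_le_mul fun μ hμ ν hν => by
      rw [Real.dist_eq, dist_eq_norm]; exact hl μ hμ ν hν
  exact this.continuousOn

theorem exists_isMinOn (h : IsOrthantPotential Φ e g) :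
    ∃ μ ∈ orthant N, ∀ ν ∈ orthant N, e μ ≤ e ν := by
  obtain ⟨c, hc, hco⟩ := h.coercive
  have h0 : (0 : EuclideanSpace ℝ (Fin N)) ∈ orthant N := fun i => le_rfl
  -- By coercivity, `e` exceeds `e 0` outside this box.
  set S : Set (EuclideanSpace ℝ (Fin N)) := {μ ∈ orthant N | ∀ i, μ i ≤ e 0 / c} with hS
  have hSc : IsCompact S := by
    have hcl : IsClosed S := by
      refine (isClosed_orthant N).inter ?_
      have : {μ : EuclideanSpace ℝ (Fin N) | ∀ i, μ i ≤ e 0 / c} = ⋂ i, {μ | μ i ≤ e 0 / c} := by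
        ext; simp
      change IsClosed {μ : EuclideanSpace ℝ (Fin N) | ∀ i, μ i ≤ e 0 / c}
      rw [this]
      exact isClosed_iInter fun i => isClosed_le (by fun_prop) continuous_const
    refine Metric.isCompact_of_isClosed_isBounded hcl ?_
    rw [isBounded_iff_forall_norm_le]
    refine ⟨√(∑ _i : Fin N, (e 0 / c) ^ 2), fun μ hμ => ?_⟩
    rw [EuclideanSpace.norm_eq]
    apply Real.sqrt_le_sqrt
    gcongr with i
    rw [Real.norm_of_nonneg (hμ.1 i)]
    exact hμ.2 i
  have h0S : (0 : EuclideanSpace ℝ (Fin N)) ∈ S := by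
    refine ⟨h0, fun i => ?_⟩
    have := hco 0 h0 i
    simp only [PiLp.zero_apply, mul_zero] at this
    exact div_nonneg this hc.le
  obtain ⟨μ, hμS, hμ⟩ := hSc.exists_isMinOn ⟨0, h0S⟩ (h.continuousOn.mono fun _ h => h.1)
  refine ⟨μ, hμS.1, fun ν hν => ?_⟩
  by_cases hνS : ν ∈ S
  · exact hμ hνS
  · obtain ⟨i, hi⟩ : ∃ i, e 0 / c < ν i := by
      by_contra hcon
      push Not at hcon
      exact hνS ⟨hν, hcon⟩
    refine (hμ h0S).trans ?_
    rw [div_lt_iff₀ hc] at hi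
    change e 0 ≤ e ν
    linarith [hco ν hν i]

end IsOrthantPotential

/-! ### The one-dimensional Skorokhod regulator. -/

/-- The regulator term `sup_{0 ≤ s ≤ t} y(s)⁻` of the one-dimensional Skorokhod problem. -/
def regulator (y : ℝ → ℝ) (t : ℝ) : ℝ :=
  -- The cut-off `max t 0` freezes the regulator for negative times, so that monotonicity and
  -- Lipschitz bounds hold on all of `ℝ`.
  sSup ((fun s => max (-(y s)) 0) '' Icc 0 (max t 0))

section Regulator

variable {y z : ℝ → ℝ}

theorem isGreatest_regulator (hy : Continuous y) (t : ℝ) :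
    IsGreatest ((fun s => max (-(y s)) 0) '' Icc 0 (max t 0)) (regulator y t) := by
  refine IsCompact.isGreatest_sSup (isCompact_Icc.image (by fun_prop)) ?_
  exact (nonempty_Icc.2 (le_max_right _ _)).image _

theorem le_regulator (hy : Continuous y) {s t : ℝ} (hs : 0 ≤ s) (hst : s ≤ max t 0) :
    max (-(y s)) 0 ≤ regulator y t :=
  (isGreatest_regulator hy t).2 ⟨s, ⟨hs, hst⟩, rfl⟩

theorem regulator_le (hy : Continuous y) {t c : ℝ}
    (h : ∀ s, 0 ≤ s → s ≤ max t 0 → max (-(y s)) 0 ≤ c) : regulator y t ≤ c := by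
  obtain ⟨s, hs, h2⟩ := (isGreatest_regulator hy t).1
  rw [← h2]; exact h s hs.1 hs.2

theorem regulator_nonneg (hy : Continuous y) (t : ℝ) : 0 ≤ regulator y t :=
  (le_max_right _ _).trans (le_regulator hy le_rfl (le_max_right t 0))

theorem neg_le_regulator (hy : Continuous y) (t : ℝ) : -(y (max t 0)) ≤ regulator y t :=
  (le_max_left _ _).trans (le_regulator hy (le_max_right t 0) le_rfl)

theorem regulator_mono (hy : Continuous y) : Monotone (regulator y) := fun _ _ h =>
  regulator_le hy fun _ h0 h1 => le_regulator hy h0 (h1.trans (max_le_max_right 0 h))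

theorem regulator_sub_le (hy : Continuous y) (hz : Continuous z) {t D : ℝ}
    (h : ∀ s, 0 ≤ s → s ≤ max t 0 → |y s - z s| ≤ D) : |regulator y t - regulator z t| ≤ D := by
  have hD : 0 ≤ D := (abs_nonneg _).trans (h 0 le_rfl (le_max_right _ _))
  rw [abs_le]
  constructor
  · suffices regulator z t ≤ regulator y t + D by linarith
    refine regulator_le hz fun s h0 h1 => ?_
    have h2 := le_regulator hy h0 h1
    have h3 := abs_le.1 (h s h0 h1)
    have h4 := le_max_left (-(y s)) 0
    exact max_le (by linarith) (by linarith [le_max_right (-(y s)) 0])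
  · suffices regulator y t ≤ regulator z t + D by linarith
    refine regulator_le hy fun s h0 h1 => ?_
    have h2 := le_regulator hz h0 h1
    have h3 := abs_le.1 (h s h0 h1)
    have h4 := le_max_left (-(z s)) 0
    exact max_le (by linarith) (by linarith [le_max_right (-(z s)) 0])

theorem regulator_zero (hy : Continuous y) (h0 : 0 ≤ y 0) : regulator y 0 = 0 := by
  refine le_antisymm (regulator_le hy fun s hs hs' => ?_) (regulator_nonneg hy 0)
  rw [max_self] at hs'
  rw [le_antisymm hs' hs]
  simpa using h0

/-- The regulator of a Lipschitz path is Lipschitz. -/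
theorem regulator_abs_sub_le (hy : Continuous y) {C : ℝ} (hC : 0 ≤ C)
    (h : ∀ s t, |y s - y t| ≤ C * |s - t|) (s t : ℝ) :
    |regulator y s - regulator y t| ≤ C * |s - t| := by
  have key : ∀ s t, s ≤ t → regulator y t ≤ regulator y s + C * (t - s) := by
    intro s t hst
    have hts : 0 ≤ C * (t - s) := mul_nonneg hC (sub_nonneg.2 hst)
    refine regulator_le hy fun r h0 h1 => ?_
    rcases le_total r (max s 0) with hr | hr
    · linarith [le_regulator hy h0 hr]
    -- After time `max s 0`, the value `-y` can exceed the old supremum only by what `y` moves in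
    -- the meantime.
    · have h2 := neg_le_regulator hy s
      have h3 := abs_le.1 (h r (max s 0))
      rw [abs_of_nonneg (sub_nonneg.2 hr)] at h3
      have h4 : r - max s 0 ≤ t - s := by
        rcases le_total s 0 with h5 | h5
        · rw [max_eq_right h5]
          rcases le_total t 0 with h6 | h6
          · rw [max_eq_right h6] at h1; linarith
          · rw [max_eq_left h6] at h1; linarith
        · rw [max_eq_left h5]
          rw [max_eq_left (h5.trans hst)] at h1; linarith
      have h5 : C * (r - max s 0) ≤ C * (t - s) := by gcongr
      exact max_le (by linarith) (by linarith [regulator_nonneg hy s])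
  rcases le_total s t with hst | hst
  · have h1 := key s t hst
    have h2 := regulator_mono hy hst
    rw [abs_sub_comm, abs_of_nonneg (sub_nonneg.2 h2), abs_sub_comm s t,
      abs_of_nonneg (sub_nonneg.2 hst)]
    linarith
  · have h1 := key t s hst
    have h2 := regulator_mono hy hst
    rw [abs_of_nonneg (sub_nonneg.2 h2), abs_of_nonneg (sub_nonneg.2 hst)]
    linarith

/-- The regulator does not grow right after a time at which the reflected path is positive. -/
theorem regulator_eventually_eq (hy : Continuous y) {t : ℝ} (ht : 0 ≤ t)
    (hpos : 0 < y t + regulator y t) : ∀ᶠ r in 𝓝[>] t, regulator y r = regulator y t := by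
  -- By continuity `-y` stays below the current supremum for a while, so no new record is set.
  have h1 : ∀ᶠ r in 𝓝 t, 0 < y r + regulator y t :=
    (Continuous.tendsto (by fun_prop : Continuous fun r => y r + regulator y t) t).eventually
      (lt_mem_nhds hpos)
  obtain ⟨ε, hε, hball⟩ := Metric.eventually_nhds_iff.1 h1
  filter_upwards [Ioo_mem_nhdsGT (show t < t + ε by linarith)] with r hr
  refine le_antisymm (regulator_le hy fun s h0 hs => ?_) (regulator_mono hy hr.1.le)
  rw [max_eq_left (ht.trans hr.1.le)] at hs
  rcases le_total s t with hst | hst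
  · exact le_regulator hy h0 (by rwa [max_eq_left ht])
  · have := hball (y := s) (by rw [Real.dist_eq, abs_of_nonneg (by linarith)]; linarith [hr.2])
    exact max_le (by linarith) (regulator_nonneg hy t)

theorem regulator_deriv_eq_zero (hy : Continuous y) {t k : ℝ} (ht : 0 ≤ t)
    (hpos : 0 < y t + regulator y t) (hk : HasDerivAt (regulator y) k t) : k = 0 := by
  have h1 : HasDerivWithinAt (regulator y) k (Ioi t) t := hk.hasDerivWithinAt
  have h2 : HasDerivWithinAt (regulator y) 0 (Ioi t) t :=
    (hasDerivWithinAt_const t (Ioi t) (regulator y t)).congr_of_eventuallyEq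
      (regulator_eventually_eq hy ht hpos) rfl
  exact (uniqueDiffWithinAt_Ioi t).eq_deriv _ h1 h2

end Regulator

/-! ### Reflection in the orthant and the reflected integral equation. -/

section Reflection

variable {N : ℕ}

theorem norm_le_sum_abs (x : EuclideanSpace ℝ (Fin N)) : ‖x‖ ≤ ∑ i, |x i| := by
  rw [EuclideanSpace.norm_eq]
  refine Real.sqrt_le_iff.2 ⟨Finset.sum_nonneg fun i _ => abs_nonneg _, ?_⟩
  simp only [Real.norm_eq_abs]
  exact Finset.sum_sq_le_sq_sum_of_nonneg fun i _ => abs_nonneg _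

theorem abs_apply_le_norm (x : EuclideanSpace ℝ (Fin N)) (i : Fin N) : |x i| ≤ ‖x‖ := by
  rw [← Real.norm_eq_abs]; exact PiLp.norm_apply_le x i

/-- The normal reflection of a path in the orthant. -/
def reflect (y : ℝ → EuclideanSpace ℝ (Fin N)) (t : ℝ) : EuclideanSpace ℝ (Fin N) :=
  WithLp.toLp 2 fun i => y (max t 0) i + regulator (fun s => y s i) t

@[simp]
theorem reflect_apply (y : ℝ → EuclideanSpace ℝ (Fin N)) (t : ℝ) (i : Fin N) :
    reflect y t i = y (max t 0) i + regulator (fun s => y s i) t := rfl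

variable {y z : ℝ → EuclideanSpace ℝ (Fin N)}

theorem reflect_mem_orthant (hy : Continuous y) (t : ℝ) : reflect y t ∈ orthant N := fun i => by
  have := neg_le_regulator (y := fun s => y s i) (by fun_prop) t
  rw [reflect_apply]; linarith

theorem measurable_reflect (hy : Continuous y) : Measurable (reflect y) := by
  have h : Measurable fun t => fun i => y (max t 0) i + regulator (fun s => y s i) t := by
    refine measurable_pi_lambda _ fun i => Measurable.add ?_ ?_
    · exact Continuous.measurable (by fun_prop)
    · exact (regulator_mono (y := fun s => y s i) (by fun_prop)).measurable
  exact (WithLp.measurable_toLp 2 _).comp h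

/-- In each of the `N` coordinates the path and its regulator contribute `D` each. Only times up to
`t` matter, and this causality is what Picard iteration needs. -/
theorem norm_reflect_sub_le (hy : Continuous y) (hz : Continuous z) {t D : ℝ}
    (h : ∀ s, 0 ≤ s → s ≤ max t 0 → ‖y s - z s‖ ≤ D) :
    ‖reflect y t - reflect z t‖ ≤ N * (2 * D) := by
  have : ∀ i, |(reflect y t - reflect z t) i| ≤ 2 * D := by
    intro i
    have h1 : ∀ s, 0 ≤ s → s ≤ max t 0 → |y s i - z s i| ≤ D := fun s h0 h1 =>
      (abs_apply_le_norm (y s - z s) i).trans (h s h0 h1)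
    have h2 := regulator_sub_le (y := fun s => y s i) (z := fun s => z s i) (by fun_prop)
      (by fun_prop) h1
    have h3 := h1 _ (le_max_right t 0) le_rfl
    rw [PiLp.sub_apply, reflect_apply, reflect_apply, add_sub_add_comm]
    exact (abs_add_le _ _).trans (by linarith)
  refine (norm_le_sum_abs _).trans ((Finset.sum_le_sum fun i _ => this i).trans ?_)
  simp

theorem norm_reflect_sub_le_of_lipschitz (hy : Continuous y) {C : ℝ} (hC : 0 ≤ C)
    (h : ∀ s t, ‖y s - y t‖ ≤ C * |s - t|) (s t : ℝ) :
    ‖reflect y s - reflect y t‖ ≤ N * (2 * C) * |s - t| := by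
  have : ∀ i, |(reflect y s - reflect y t) i| ≤ 2 * C * |s - t| := by
    intro i
    have h1 : ∀ s t, |y s i - y t i| ≤ C * |s - t| := fun s t =>
      (abs_apply_le_norm (y s - y t) i).trans (h s t)
    have h2 := regulator_abs_sub_le (y := fun s => y s i) (by fun_prop) hC h1 s t
    have h3 := h1 (max s 0) (max t 0)
    have h4 : C * |max s 0 - max t 0| ≤ C * |s - t| :=
      mul_le_mul_of_nonneg_left (abs_max_sub_max_le_abs s t 0) hC
    rw [PiLp.sub_apply, reflect_apply, reflect_apply, add_sub_add_comm]
    exact (abs_add_le _ _).trans (by linarith)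
  refine (norm_le_sum_abs _).trans ((Finset.sum_le_sum fun i _ => this i).trans ?_)
  simp [mul_assoc]

/-- The primitive, stopped at `0`, of a bounded function is Lipschitz. -/
theorem norm_integral_sub_integral_le {h : ℝ → EuclideanSpace ℝ (Fin N)} (hm : Measurable h)
    {C : ℝ} (hb : ∀ s, ‖h s‖ ≤ C) (s t : ℝ) :
    ‖(∫ r in (0 : ℝ)..max s 0, h r) - ∫ r in (0 : ℝ)..max t 0, h r‖ ≤ C * |s - t| := by
  have hi : ∀ a b : ℝ, IntervalIntegrable h volume a b := fun a b =>
    (intervalIntegrable_const (c := C)).mono_fun hm.aestronglyMeasurable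
      (ae_of_all _ fun s => (hb s).trans (le_abs_self C))
  have hC : 0 ≤ C := (norm_nonneg _).trans (hb 0)
  rw [intervalIntegral.integral_interval_sub_left (hi _ _) (hi _ _)]
  refine (intervalIntegral.norm_integral_le_of_norm_le_const fun r _ => hb r).trans ?_
  exact mul_le_mul_of_nonneg_left (abs_max_sub_max_le_abs s t 0) hC

/-- Existence for the integral equation with reflection. -/
theorem exists_reflected_path {G : EuclideanSpace ℝ (Fin N) → EuclideanSpace ℝ (Fin N)}
    {C L : ℝ} (hb : ∀ μ, ‖G μ‖ ≤ C) (hL : 0 ≤ L) (hl : ∀ μ ν, ‖G μ - G ν‖ ≤ L * ‖μ - ν‖)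
    (μ₀ : EuclideanSpace ℝ (Fin N)) :
    ∃ y : ℝ → EuclideanSpace ℝ (Fin N), Continuous y ∧
      ∀ t, y t = μ₀ - ∫ s in (0 : ℝ)..max t 0, G (reflect y s) := by
  have hGc : Continuous G := (LipschitzWith.of_dist_le_mul (K := ⟨L, hL⟩) fun μ ν => by
    rw [dist_eq_norm, dist_eq_norm]; exact hl μ ν).continuous
  have hC : 0 ≤ C := (norm_nonneg _).trans (hb 0)
  set K : ℝ := L * (N * 2) with hK
  have hK0 : 0 ≤ K := by positivity
  -- The unknown is rescaled by `exp (-(lam * t))`. The contraction constant is then at most `K /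
  -- lam ≤ 1 / 2`; the summand `1` keeps `lam` positive when `K = 0`.
  set lam : ℝ := 2 * K + 1 with hlam
  have hlam0 : 0 < lam := by positivity
  let w : (ℝ → EuclideanSpace ℝ (Fin N)) → ℝ → EuclideanSpace ℝ (Fin N) :=
    fun z s => Real.exp (lam * max s 0) • z s
  have hw : ∀ z, Continuous z → Continuous (w z) := fun z hz => by
    simp only [w]; fun_prop
  let I : (ℝ → EuclideanSpace ℝ (Fin N)) → ℝ → EuclideanSpace ℝ (Fin N) :=
    fun z t => ∫ s in (0 : ℝ)..max t 0, G (reflect (w z) s)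
  have hm : ∀ z, Continuous z → Measurable fun s => G (reflect (w z) s) := fun z hz =>
    hGc.measurable.comp (measurable_reflect (hw z hz))
  have hIl : ∀ z, Continuous z → ∀ s t, ‖I z s - I z t‖ ≤ C * |s - t| := fun z hz s t =>
    norm_integral_sub_integral_le (hm z hz) (fun s => hb _) s t
  have hIc : ∀ z, Continuous z → Continuous (I z) := fun z hz =>
    (LipschitzWith.of_dist_le_mul (K := ⟨C, hC⟩) fun s t => by
      rw [dist_eq_norm, Real.dist_eq]; exact hIl z hz s t).continuous
  let Ψ : (ℝ → EuclideanSpace ℝ (Fin N)) → ℝ → EuclideanSpace ℝ (Fin N) :=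
    fun z t => Real.exp (-(lam * max t 0)) • (μ₀ - I z t)
  have hΨc : ∀ z, Continuous z → Continuous (Ψ z) := fun z hz => by
    have := hIc z hz
    simp only [Ψ]; fun_prop
  -- The integral grows at most linearly, so the weight makes the image bounded and the iteration
  -- acts on bounded continuous functions.
  have hΨb : ∀ z, Continuous z → ∀ t, ‖Ψ z t‖ ≤ ‖μ₀‖ + C / lam := by
    intro z hz t
    have h1 : ‖I z t‖ ≤ C * max t 0 := by
      have := intervalIntegral.norm_integral_le_of_norm_le_const (a := (0 : ℝ)) (b := max t 0)
        (f := fun s => G (reflect (w z) s)) (C := C) (fun r _ => hb _)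
      rwa [sub_zero, abs_of_nonneg (le_max_right t 0)] at this
    have h2 : lam * max t 0 ≤ Real.exp (lam * max t 0) := by
      linarith [Real.add_one_le_exp (lam * max t 0)]
    have h3 : 1 ≤ Real.exp (lam * max t 0) :=
      Real.one_le_exp (mul_nonneg hlam0.le (le_max_right t 0))
    simp only [Ψ]
    rw [norm_smul, Real.norm_of_nonneg (Real.exp_nonneg _), Real.exp_neg,
      inv_mul_le_iff₀ (Real.exp_pos _)]
    have h4 : C * max t 0 ≤ Real.exp (lam * max t 0) * (C / lam) := by
      rw [mul_div_assoc', le_div_iff₀ hlam0]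
      calc _ = lam * max t 0 * C := by ring
        _ ≤ _ := by gcongr
    have h5 : ‖μ₀‖ ≤ Real.exp (lam * max t 0) * ‖μ₀‖ :=
      le_mul_of_one_le_left (norm_nonneg _) h3
    calc _ ≤ ‖μ₀‖ + ‖I z t‖ := norm_sub_le _ _
      _ ≤ _ := by rw [mul_add]; linarith
  let Θ : BoundedContinuousFunction ℝ (EuclideanSpace ℝ (Fin N)) →
      BoundedContinuousFunction ℝ (EuclideanSpace ℝ (Fin N)) := fun z =>
    BoundedContinuousFunction.ofNormedAddCommGroup (Ψ z) (hΨc z z.continuous) _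
      (hΨb z z.continuous)
  have hΘ : ContractingWith (1 / 2) Θ := by
    refine ⟨by rw [← NNReal.coe_lt_coe]; norm_num, LipschitzWith.of_dist_le_mul fun z z' => ?_⟩
    rw [BoundedContinuousFunction.dist_le (by positivity)]
    intro t
    set D := dist z z' with hD
    have hD0 : 0 ≤ D := dist_nonneg
    have hz := z.continuous
    have hz' := z'.continuous
    have hdiff : ∀ s, 0 ≤ s → ‖G (reflect (w z) s) - G (reflect (w z') s)‖ ≤
        K * D * Real.exp (lam * s) := by
      intro s hs
      refine (hl _ _).trans ?_
      have := norm_reflect_sub_le (hw z hz) (hw z' hz') (t := s) (D := Real.exp (lam * s) * D) ?_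
      · calc _ ≤ L * (N * (2 * (Real.exp (lam * s) * D))) := by gcongr
          _ = _ := by rw [hK]; ring
      · intro r hr hrs
        rw [max_eq_left hs] at hrs
        simp only [w]
        rw [← smul_sub, norm_smul, Real.norm_of_nonneg (Real.exp_nonneg _), max_eq_left hr]
        have : ‖z r - z' r‖ ≤ D := by
          rw [← dist_eq_norm]; exact BoundedContinuousFunction.dist_coe_le_dist r
        gcongr
    have hint : ∀ z : ℝ → EuclideanSpace ℝ (Fin N), Continuous z →
        IntervalIntegrable (fun s => G (reflect (w z) s)) volume 0 (max t 0) := fun z hz =>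
      (intervalIntegrable_const (c := C)).mono_fun (hm z hz).aestronglyMeasurable
        (ae_of_all _ fun s => (hb _).trans (le_abs_self C))
    have hI : ‖I z t - I z' t‖ ≤ K * D * (Real.exp (lam * max t 0) / lam) := by
      simp only [I]
      rw [← intervalIntegral.integral_sub (hint z hz) (hint z' hz')]
      refine (intervalIntegral.norm_integral_le_of_norm_le
        (g := fun s => K * D * Real.exp (lam * s)) (le_max_right t 0)
        (ae_of_all _ fun s hs => hdiff s hs.1.le)
        (Continuous.intervalIntegrable (by fun_prop) _ _)).trans ?_
      rw [intervalIntegral.integral_const_mul, intervalIntegral.integral_comp_mul_left _ hlam0.ne',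
        integral_exp]
      have : lam⁻¹ • (Real.exp (lam * max t 0) - Real.exp (lam * 0)) ≤
          Real.exp (lam * max t 0) / lam := by
        rw [smul_eq_mul, inv_mul_eq_div]
        gcongr
        linarith [Real.exp_pos (lam * 0)]
      gcongr
    change dist (Ψ z t) (Ψ z' t) ≤ _
    rw [dist_eq_norm]
    simp only [Ψ]
    rw [← smul_sub, sub_sub_sub_cancel_left, norm_smul, Real.norm_of_nonneg (Real.exp_nonneg _),
      Real.exp_neg, inv_mul_le_iff₀ (Real.exp_pos _), norm_sub_rev]
    refine hI.trans ?_
    have : K / lam ≤ 1 / 2 := by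
      rw [div_le_div_iff₀ hlam0 two_pos]; linarith
    calc _ = K / lam * (Real.exp (lam * max t 0) * D) := by ring
      _ ≤ 1 / 2 * (Real.exp (lam * max t 0) * D) := by gcongr
      _ = _ := by push_cast; ring
  obtain ⟨z, hz⟩ : ∃ z, Θ z = z := ⟨_, hΘ.fixedPoint_isFixedPt⟩
  refine ⟨w z, hw z z.continuous, fun t => ?_⟩
  have h1 : z t = Ψ z t := by
    conv_lhs => rw [← hz]
    rfl
  change Real.exp (lam * max t 0) • z t = μ₀ - I z t
  rw [h1]
  simp only [Ψ]
  rw [smul_smul, ← Real.exp_add, add_neg_cancel, Real.exp_zero, one_smul]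

end Reflection

/-! ### Calculus for absolutely continuous curves. -/

section AbsolutelyContinuous

theorem _root_.AbsolutelyContinuousOnInterval.norm {F : Type*} [NormedAddCommGroup F]
    {u : ℝ → F} {a b : ℝ} (hu : AbsolutelyContinuousOnInterval u a b) :
    AbsolutelyContinuousOnInterval (fun t => ‖u t‖) a b := by
  refine squeeze_zero (fun _ => Finset.sum_nonneg fun _ _ => dist_nonneg) (fun E => ?_) hu
  exact Finset.sum_le_sum fun i _ => by
    rw [Real.dist_eq, dist_eq_norm]; exact abs_norm_sub_norm_le _ _

theorem _root_.AbsolutelyContinuousOnInterval.norm_sq {F : Type*} [NormedAddCommGroup F]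
    {u : ℝ → F} {a b : ℝ} (hu : AbsolutelyContinuousOnInterval u a b) :
    AbsolutelyContinuousOnInterval (fun t => ‖u t‖ ^ 2) a b := by
  simpa [pow_two] using hu.norm.fun_mul hu.norm

/-- An absolutely continuous function with a.e. nonpositive derivative does not increase. -/
theorem _root_.AbsolutelyContinuousOnInterval.le_of_ae_deriv_nonpos {φ : ℝ → ℝ} {a b : ℝ}
    (hab : a ≤ b) (hφ : AbsolutelyContinuousOnInterval φ a b)
    (hd : ∀ᵐ t, t ∈ Ioc a b → deriv φ t ≤ 0) : φ b ≤ φ a := by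
  have h1 := hφ.integral_deriv_eq_sub
  have h2 : ∫ t in a..b, deriv φ t ≤ 0 := by
    rw [intervalIntegral.integral_of_le hab]
    exact integral_nonpos_of_ae ((ae_restrict_iff' measurableSet_Ioc).2 hd)
  linarith

theorem ae_Ioc_of_ae_Ioi {p : ℝ → Prop} (h : ∀ᵐ t ∂(volume.restrict (Ioi (0 : ℝ))), p t)
    {a : ℝ} (ha : 0 ≤ a) (b : ℝ) : ∀ᵐ t, t ∈ Ioc a b → p t := by
  rw [ae_restrict_iff' measurableSet_Ioi] at h
  filter_upwards [h] with t ht hab using ht (ha.trans_lt hab.1)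

end AbsolutelyContinuous

theorem hasDerivAt_euclidean {N : ℕ} {γ : ℝ → EuclideanSpace ℝ (Fin N)}
    {v : EuclideanSpace ℝ (Fin N)} {t : ℝ} :
    HasDerivAt γ v t ↔ ∀ i, HasDerivAt (fun s => γ s i) (v i) t := by
  rw [hasDerivAt_iff_hasFDerivAt, ← hasFDerivWithinAt_univ, hasFDerivWithinAt_euclidean]
  refine forall_congr' fun i => ?_
  rw [hasFDerivWithinAt_univ, hasDerivAt_iff_hasFDerivAt]
  refine iff_of_eq (congrArg (fun A => HasFDerivAt (fun s => γ s i) A t) ?_)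
  ext
  simp

/-! ### The gradient flow: existence, energy identity, uniqueness, convergence. -/

namespace IsOrthantPotential

variable {N : ℕ} {Φ : EuclideanSpace ℝ (Fin N) → EReal} {e : EuclideanSpace ℝ (Fin N) → ℝ}
  {g : EuclideanSpace ℝ (Fin N) → EuclideanSpace ℝ (Fin N)}

/-- Existence of a solution of the flow. -/
theorem exists_solution (h : IsOrthantPotential Φ e g) {μ₀ : EuclideanSpace ℝ (Fin N)}
    (hμ₀ : μ₀ ∈ orthant N) :
    ∃ γ : ℝ → EuclideanSpace ℝ (Fin N), IsAdmissibleCurve μ₀ γ ∧ SolvesFlowAE Φ γ := by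
  obtain ⟨C, hC, hb⟩ := h.bounded
  obtain ⟨L, hL, hl⟩ := h.lipschitz
  -- Composing `g` with the nearest-point projection `P` onto the orthant extends it to the whole
  -- space; reflected paths stay in the orthant, where `P` is the identity.
  let P : EuclideanSpace ℝ (Fin N) → EuclideanSpace ℝ (Fin N) := fun μ =>
    WithLp.toLp 2 fun i => max (μ i) 0
  have hP : ∀ μ, P μ ∈ orthant N := fun μ i => le_max_right _ _
  have hPo : ∀ μ ∈ orthant N, P μ = μ := fun μ hμ => by
    ext i; exact max_eq_left (hμ i)
  have hPl : ∀ μ ν, ‖P μ - P ν‖ ≤ ‖μ - ν‖ := fun μ ν => by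
    rw [EuclideanSpace.norm_eq, EuclideanSpace.norm_eq]
    apply Real.sqrt_le_sqrt
    refine Finset.sum_le_sum fun i _ => ?_
    rw [PiLp.sub_apply, PiLp.sub_apply, Real.norm_eq_abs, Real.norm_eq_abs]
    have := abs_max_sub_max_le_abs (μ i) (ν i) 0
    change |max (μ i) 0 - max (ν i) 0| ^ 2 ≤ _
    gcongr
  let G : EuclideanSpace ℝ (Fin N) → EuclideanSpace ℝ (Fin N) := fun μ => g (P μ)
  have hGb : ∀ μ, ‖G μ‖ ≤ C := fun μ => hb _ (hP μ)
  have hGl : ∀ μ ν, ‖G μ - G ν‖ ≤ L * ‖μ - ν‖ := fun μ ν =>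
    (hl _ (hP μ) _ (hP ν)).trans (mul_le_mul_of_nonneg_left (hPl μ ν) hL)
  have hGc : Continuous G := (LipschitzWith.of_dist_le_mul (K := ⟨L, hL⟩) fun μ ν => by
    rw [dist_eq_norm, dist_eq_norm]; exact hGl μ ν).continuous
  obtain ⟨y, hyc, hy⟩ := exists_reflected_path hGb hL hGl μ₀
  have hyl : ∀ s t, ‖y s - y t‖ ≤ C * |s - t| := fun s t => by
    rw [hy s, hy t, sub_sub_sub_cancel_left, norm_sub_rev]
    exact norm_integral_sub_integral_le (hGc.measurable.comp (measurable_reflect hyc))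
      (fun s => hGb _) s t
  have hxl := norm_reflect_sub_le_of_lipschitz hyc hC hyl
  have hxm := reflect_mem_orthant hyc
  have hxc : Continuous (reflect y) :=
    (LipschitzWith.of_dist_le_mul (K := ⟨N * (2 * C), by positivity⟩) fun s t => by
      rw [dist_eq_norm, Real.dist_eq]; exact hxl s t).continuous
  have hy0 : y 0 = μ₀ := by rw [hy 0]; simp
  have hyi : ∀ i, Continuous fun s => y s i := fun i => by fun_prop
  have hyd : ∀ t, 0 < t → HasDerivAt y (-g (reflect y t)) t := by
    intro t ht
    have hc : Continuous fun s => G (reflect y s) := hGc.comp hxc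
    have h1 : HasDerivAt (fun t => μ₀ - ∫ s in (0 : ℝ)..t, G (reflect y s))
        (-G (reflect y t)) t :=
      (intervalIntegral.integral_hasDerivAt_right (hc.intervalIntegrable _ _)
        (hc.stronglyMeasurableAtFilter _ _) hc.continuousAt).const_sub μ₀
    have h2 : G (reflect y t) = g (reflect y t) := by simp only [G, hPo _ (hxm t)]
    rw [h2] at h1
    refine h1.congr_of_eventuallyEq ?_
    filter_upwards [lt_mem_nhds ht] with s hs
    rw [hy s, max_eq_left hs.le]
  have hkd : ∀ᵐ t, ∀ i, DifferentiableAt ℝ (regulator fun s => y s i) t := by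
    rw [ae_all_iff]
    intro i
    exact (LipschitzWith.of_dist_le_mul (K := ⟨C, hC⟩) fun s t => by
      rw [Real.dist_eq, Real.dist_eq]
      exact regulator_abs_sub_le (hyi i) hC
        (fun s t => (abs_apply_le_norm (y s - y t) i).trans (hyl s t)) s t).ae_differentiableAt_real
  have hflow : SolvesFlowAE Φ (reflect y) := by
    rw [SolvesFlowAE, ae_restrict_iff' measurableSet_Ioi]
    filter_upwards [hkd] with t htd (ht : 0 < t)
    rw [h.minimalSubgradient_eq (hxm t), hasDerivAt_euclidean]
    intro i
    have hk := (htd i).hasDerivAt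
    set k := deriv (regulator fun s => y s i) t
    have hyi' : HasDerivAt (fun s => y s i) (-g (reflect y t) i) t :=
      (hasDerivAt_euclidean.1 (hyd t ht)) i
    have hx : HasDerivAt (fun s => reflect y s i) (-g (reflect y t) i + k) t := by
      refine (hyi'.add hk).congr_of_eventuallyEq ?_
      filter_upwards [lt_mem_nhds ht] with s hs
      simp [max_eq_left (le_of_lt hs)]
    convert! hx using 1
    rw [PiLp.neg_apply, projTangent_apply]
    split_ifs with hpos
    · have : k = 0 := regulator_deriv_eq_zero (hyi i) ht.le
        (by rwa [reflect_apply, max_eq_left ht.le] at hpos) hk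
      rw [this, add_zero]
    · have h0 : reflect y t i = 0 := le_antisymm (not_lt.1 hpos) (hxm t i)
      -- A coordinate at zero is at its minimum, so its derivative vanishes and `k = g i`. As `k ≥
      -- 0`, the entry `min (g i) 0` of the minimal subgradient is zero too.
      have hmin : IsLocalMin (fun s => reflect y s i) t :=
        Filter.Eventually.of_forall fun s => by
          change reflect y t i ≤ reflect y s i
          rw [h0]; exact hxm s i
      have h1 : -g (reflect y t) i + k = 0 := hmin.hasDerivAt_eq_zero hx
      have h2 : 0 ≤ k := (regulator_mono (hyi i)).deriv_nonneg
      rw [h1, min_eq_right (by linarith), neg_zero]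
  refine ⟨reflect y, ⟨?_, fun t _ => hxm t, fun t _ => ?_, ?_⟩, hflow⟩
  · ext i
    rw [reflect_apply, max_self, hy0, regulator_zero (hyi i) (by rw [hy0]; exact hμ₀ i), add_zero]
  · exact LipschitzOnWith.absolutelyContinuousOnInterval (K := ⟨N * (2 * C), by positivity⟩)
      (LipschitzOnWith.of_dist_le_mul fun s _ t _ => by
        rw [dist_eq_norm, Real.dist_eq]; exact hxl s t)
  · filter_upwards [hflow] with t ht using ht.differentiableAt

/-- The chain rule for `e` along a curve in the orthant. -/
theorem deriv_comp_eq (h : IsOrthantPotential Φ e g) {γ : ℝ → EuclideanSpace ℝ (Fin N)}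
    (hγ : ∀ t, 0 ≤ t → γ t ∈ orthant N) {t a : ℝ} (ht : 0 < t)
    {v : EuclideanSpace ℝ (Fin N)} (hv : HasDerivAt γ v t)
    (ha : HasDerivAt (fun s => e (γ s)) a t) : a = inner ℝ (minimalSubgradient Φ (γ t)) v := by
  set ξ := minimalSubgradient Φ (γ t)
  -- Subtracting the supporting affine function leaves a function of time with a minimum at `t`, so
  -- `e` itself need not be differentiable.
  have h1 : HasDerivAt (fun s => e (γ s) - inner ℝ ξ (γ s - γ t)) (a - inner ℝ ξ v) t := by
    refine ha.sub ?_
    have := (hasDerivAt_const t ξ).inner ℝ (hv.sub_const (γ t))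
    simpa using this
  have hmin : IsLocalMin (fun s => e (γ s) - inner ℝ ξ (γ s - γ t)) t := by
    filter_upwards [lt_mem_nhds ht] with s hs
    have := h.le_of_minimalSubgradient (hγ t ht.le) (hγ s (le_of_lt hs))
    simp only [sub_self, inner_zero_right, sub_zero]
    linarith
  have := hmin.hasDerivAt_eq_zero h1
  linarith

theorem absolutelyContinuous_comp (h : IsOrthantPotential Φ e g)
    {μ₀ : EuclideanSpace ℝ (Fin N)} {γ : ℝ → EuclideanSpace ℝ (Fin N)}
    (hγ : IsAdmissibleCurve μ₀ γ) {a b : ℝ} (ha : 0 ≤ a) (hab : a ≤ b) :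
    AbsolutelyContinuousOnInterval (fun t => e (γ t)) a b := by
  obtain ⟨C, hC, hl⟩ := h.exists_lipschitz
  have h1 : AbsolutelyContinuousOnInterval γ a b :=
    (hγ.locallyAC b (ha.trans hab)).mono (by
      rw [uIcc_of_le hab, uIcc_of_le (ha.trans hab)]; exact Icc_subset_Icc_left ha)
  unfold AbsolutelyContinuousOnInterval at h1 ⊢
  have h2 := h1.const_mul C
  rw [mul_zero] at h2
  refine squeeze_zero' (Eventually.of_forall fun _ => Finset.sum_nonneg fun _ _ => dist_nonneg)
    ?_ h2
  -- The principal part of the filter confines all endpoints to `[a, b]`, where `γ` lies in the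
  -- orthant and the Lipschitz bound for `e` applies.
  filter_upwards [mem_inf_of_right (mem_principal_self _)] with E hE
  rw [Finset.mul_sum]
  refine Finset.sum_le_sum fun i hi => ?_
  obtain ⟨hE1, hE2⟩ := hE.1 i hi
  rw [uIcc_of_le hab] at hE1 hE2
  rw [Real.dist_eq, dist_eq_norm]
  exact hl _ (hγ.mem_orthant _ (ha.trans hE1.1)) _ (hγ.mem_orthant _ (ha.trans hE2.1))

/-- Solutions of the differential inclusion dissipate energy at the rate `‖∂°Φ‖²`. -/
theorem ae_deriv_comp_eq (h : IsOrthantPotential Φ e g)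
    {μ₀ : EuclideanSpace ℝ (Fin N)} {γ : ℝ → EuclideanSpace ℝ (Fin N)}
    (hγ : IsAdmissibleCurve μ₀ γ) (hflow : SolvesFlowAE Φ γ) {t : ℝ} (ht : 0 ≤ t) :
    ∀ᵐ s, s ∈ Ioc 0 t → deriv (fun s => e (γ s)) s = -‖minimalSubgradient Φ (γ s)‖ ^ 2 := by
  filter_upwards [(h.absolutelyContinuous_comp hγ le_rfl ht).ae_differentiableAt,
    ae_Ioc_of_ae_Ioi hflow le_rfl t] with s h1 h2 hs
  have h3 := (h1 (by rw [uIcc_of_le ht]; exact Ioc_subset_Icc_self hs)).hasDerivAt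
  rw [h.deriv_comp_eq hγ.mem_orthant hs.1 (h2 hs) h3, inner_neg_right, real_inner_self_eq_norm_sq]

theorem energyIdentity_of_solvesFlowAE (h : IsOrthantPotential Φ e g)
    {μ₀ : EuclideanSpace ℝ (Fin N)} {γ : ℝ → EuclideanSpace ℝ (Fin N)}
    (hγ : IsAdmissibleCurve μ₀ γ) (hflow : SolvesFlowAE Φ γ) : EnergyIdentity Φ γ := by
  intro t ht
  have hac := h.absolutelyContinuous_comp hγ le_rfl ht
  have hd := h.ae_deriv_comp_eq hγ hflow ht
  have hint : IntervalIntegrable (fun s => ‖minimalSubgradient Φ (γ s)‖ ^ 2) volume 0 t := by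
    refine hac.intervalIntegrable_deriv.neg.congr_ae ?_
    rw [EventuallyEq, ae_restrict_iff' measurableSet_uIoc]
    filter_upwards [hd] with s hs hst
    rw [uIoc_of_le ht] at hst
    simp [hs hst]
  refine ⟨hint, ?_⟩
  have h1 := hac.integral_deriv_eq_sub
  have h2 : ∫ s in (0 : ℝ)..t, deriv (fun s => e (γ s)) s =
      ∫ s in (0 : ℝ)..t, -‖minimalSubgradient Φ (γ s)‖ ^ 2 := by
    refine intervalIntegral.integral_congr_ae ?_
    rw [uIoc_of_le ht]
    exact hd
  rw [intervalIntegral.integral_neg] at h2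
  rw [h.eq_coe _ (hγ.mem_orthant t ht), h.eq_coe _ (hγ.mem_orthant 0 le_rfl), ← EReal.coe_sub]
  congr 1
  linarith

theorem isEnergySolution_of_solvesFlowAE (h : IsOrthantPotential Φ e g)
    {μ₀ : EuclideanSpace ℝ (Fin N)} {γ : ℝ → EuclideanSpace ℝ (Fin N)}
    (hγ : IsAdmissibleCurve μ₀ γ) (hflow : SolvesFlowAE Φ γ) : IsEnergySolution Φ μ₀ γ := by
  refine ⟨hγ, h.energyIdentity_of_solvesFlowAE hγ hflow, ?_⟩
  filter_upwards [hflow] with t ht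
  rw [ht.deriv, norm_neg]

/-- Differentiating the energy identity and applying the chain rule gives `⟪ξ, γ'⟫ = -‖ξ‖²`. With
`‖γ'‖ = ‖ξ‖` this yields `‖γ' + ξ‖² = 0`. -/
theorem solvesFlowAE_of_isEnergySolution (h : IsOrthantPotential Φ e g)
    {μ₀ : EuclideanSpace ℝ (Fin N)} {γ : ℝ → EuclideanSpace ℝ (Fin N)}
    (hγ : IsEnergySolution Φ μ₀ γ) : SolvesFlowAE Φ γ := by
  have hmem := hγ.admissible.mem_orthant
  set q : ℝ → ℝ := fun s => ‖minimalSubgradient Φ (γ s)‖ ^ 2 with hq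
  have hid : ∀ t, 0 ≤ t → e (γ t) = e (γ 0) - ∫ s in (0 : ℝ)..t, q s := fun t ht => by
    have := (hγ.energyIdentity t ht).2
    rw [h.eq_coe _ (hmem t ht), h.eq_coe _ (hmem 0 le_rfl), ← EReal.coe_sub] at this
    exact_mod_cast this
  have hde : ∀ᵐ t, 0 < t → HasDerivAt (fun s => e (γ s)) (-q t) t := by
    have hn : ∀ n : ℕ, ∀ᵐ t, t ∈ uIcc 0 (n : ℝ) →
        HasDerivAt (fun t => ∫ s in (0 : ℝ)..t, q s) (q t) t := fun n => by
      have := (hγ.energyIdentity n n.cast_nonneg).1.ae_hasDerivAt_integral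
      filter_upwards [this] with t ht hmem using ht hmem 0 left_mem_uIcc
    rw [← ae_all_iff] at hn
    filter_upwards [hn] with t ht h0
    obtain ⟨n, hn⟩ := exists_nat_ge t
    have h1 := (ht n (by rw [uIcc_of_le n.cast_nonneg]; exact ⟨h0.le, hn⟩)).const_sub (e (γ 0))
    refine h1.congr_of_eventuallyEq ?_
    filter_upwards [lt_mem_nhds h0] with s hs using hid s (le_of_lt hs)
  rw [SolvesFlowAE]
  filter_upwards [hγ.admissible.ae_differentiable, hγ.speed,
    (ae_restrict_iff' measurableSet_Ioi).2 hde, ae_restrict_mem measurableSet_Ioi] with t h1 h2 h3 h4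
  set ξ := minimalSubgradient Φ (γ t) with hξ
  have h5 : -‖ξ‖ ^ 2 = inner ℝ ξ (deriv γ t) := h.deriv_comp_eq hmem h4 h1.hasDerivAt h3
  have h6 : ‖deriv γ t + ξ‖ ^ 2 = 0 := by
    rw [norm_add_sq_real, h2, real_inner_comm, ← h5]; ring
  have h7 : deriv γ t = -ξ := by
    rw [← add_eq_zero_iff_eq_neg]
    exact norm_eq_zero.1 (pow_eq_zero_iff two_ne_zero |>.1 h6)
  rw [← h7]
  exact h1.hasDerivAt

/-- Solutions of the flow with the same initial value agree. -/
theorem eqOn_of_solvesFlowAE (h : IsOrthantPotential Φ e g)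
    {μ₀ : EuclideanSpace ℝ (Fin N)} {γ η : ℝ → EuclideanSpace ℝ (Fin N)}
    (hγ : IsAdmissibleCurve μ₀ γ) (hγf : SolvesFlowAE Φ γ)
    (hη : IsAdmissibleCurve μ₀ η) (hηf : SolvesFlowAE Φ η) : EqOn η γ (Ici 0) := by
  intro t (ht : 0 ≤ t)
  have hac : AbsolutelyContinuousOnInterval (fun s => ‖η s - γ s‖ ^ 2) 0 t :=
    ((hη.locallyAC t ht).fun_sub (hγ.locallyAC t ht)).norm_sq
  have hle := hac.le_of_ae_deriv_nonpos ht (by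
    filter_upwards [ae_Ioc_of_ae_Ioi hγf le_rfl t, ae_Ioc_of_ae_Ioi hηf le_rfl t] with s h1 h2 hs
    rw [((h2 hs).fun_sub (h1 hs)).norm_sq.deriv]
    -- Adding the two subgradient inequalities gives monotonicity of the subdifferential, so the
    -- squared distance does not grow.
    have h3 := h.le_of_minimalSubgradient (hγ.mem_orthant s hs.1.le) (hη.mem_orthant s hs.1.le)
    have h4 := h.le_of_minimalSubgradient (hη.mem_orthant s hs.1.le) (hγ.mem_orthant s hs.1.le)
    rw [← neg_sub (η s) (γ s), inner_neg_right] at h4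
    rw [inner_sub_right, inner_neg_right, inner_neg_right, real_inner_comm,
      real_inner_comm _ (η s - γ s)]
    linarith)
  simp only [hη.init, hγ.init, sub_self, norm_zero] at hle
  have : ‖η t - γ t‖ ^ 2 = 0 := le_antisymm (by simpa using hle) (sq_nonneg _)
  exact sub_eq_zero.1 (norm_eq_zero.1 (pow_eq_zero_iff two_ne_zero |>.1 this))

/-- Convergence of solutions to a minimizer. -/
theorem exists_tendsto (h : IsOrthantPotential Φ e g)
    {μ₀ : EuclideanSpace ℝ (Fin N)} {γ : ℝ → EuclideanSpace ℝ (Fin N)}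
    (hγ : IsAdmissibleCurve μ₀ γ) (hflow : SolvesFlowAE Φ γ) :
    ∃ μ ∈ orthant N, IsMinOn Φ (orthant N) μ ∧ Tendsto γ atTop (𝓝 μ) := by
  have hmem := hγ.mem_orthant
  have hacE : ∀ {a b : ℝ}, 0 ≤ a → a ≤ b → AbsolutelyContinuousOnInterval γ a b :=
    fun {a b} ha hab => (hγ.locallyAC b (ha.trans hab)).mono (by
      rw [uIcc_of_le hab, uIcc_of_le (ha.trans hab)]; exact Icc_subset_Icc_left ha)
  have hdec : ∀ s t, 0 ≤ s → s ≤ t → e (γ t) ≤ e (γ s) := fun s t hs hst =>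
    (h.absolutelyContinuous_comp hγ hs hst).le_of_ae_deriv_nonpos hst (by
      filter_upwards [h.ae_deriv_comp_eq hγ hflow (hs.trans hst)] with r hr hrs
      rw [hr ⟨hs.trans_lt hrs.1, hrs.2⟩]
      simp)
  -- The function `‖γ r - μ‖² + 2 (r - s) (e (γ t) - e μ)` of `r`, with the energy frozen at the
  -- final time `t`, has derivative at most `2 (e (γ t) - e (γ r)) ≤ 0`.
  have hdist : ∀ μ ∈ orthant N, (∀ ν ∈ orthant N, e μ ≤ e ν) → ∀ s t, 0 ≤ s → s ≤ t →
      ‖γ t - μ‖ ^ 2 + 2 * (t - s) * (e (γ t) - e μ) ≤ ‖γ s - μ‖ ^ 2 := by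
    intro μ hμ hmin s t hs hst
    have hlin : AbsolutelyContinuousOnInterval
        (fun r => 2 * (r - s) * (e (γ t) - e μ)) s t :=
      ContDiffOn.absolutelyContinuousOnInterval (ContDiff.contDiffOn (by fun_prop))
    have hconst : AbsolutelyContinuousOnInterval (fun _ : ℝ => μ) s t :=
      ContDiffOn.absolutelyContinuousOnInterval (ContDiff.contDiffOn (by fun_prop))
    have hac := ((hacE hs hst).fun_sub hconst).norm_sq.fun_add hlin
    have := hac.le_of_ae_deriv_nonpos hst (by
      filter_upwards [ae_Ioc_of_ae_Ioi hflow hs t] with r h1 hr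
      have hd : HasDerivAt (fun r : ℝ => 2 * (r - s) * (e (γ t) - e μ))
          (2 * 1 * (e (γ t) - e μ)) r :=
        (((hasDerivAt_id r).sub_const s).const_mul 2).mul_const _
      have hr0 : 0 ≤ r := hs.trans hr.1.le
      have hd' := ((h1 hr).sub_const μ).norm_sq.fun_add hd
      rw [hd'.deriv]
      have h3 := h.le_of_minimalSubgradient (hmem r hr0) hμ
      have h4 := hdec r t hr0 hr.2
      rw [← neg_sub (γ r) μ, inner_neg_right, real_inner_comm] at h3
      rw [inner_neg_right]
      linarith)
    simpa using this
  obtain ⟨μs, hμs, hmins⟩ := h.exists_isMinOn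
  have hbdd : ∀ t, 0 ≤ t → ‖γ t - μs‖ ≤ ‖γ 0 - μs‖ := fun t ht => by
    have h1 := hdist μs hμs hmins 0 t le_rfl ht
    have h2 : 0 ≤ 2 * (t - 0) * (e (γ t) - e μs) :=
      mul_nonneg (by linarith) (sub_nonneg.2 (hmins _ (hmem t ht)))
    exact le_of_sq_le_sq (by linarith) (norm_nonneg _)
  have hlim : Tendsto (fun t => e (γ t)) atTop (𝓝 (e μs)) := by
    have hup : Tendsto (fun t : ℝ => e μs + ‖γ 0 - μs‖ ^ 2 / 2 / t) atTop (𝓝 (e μs)) := by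
      simpa using (tendsto_const_nhds (x := e μs)).add
        (tendsto_const_nhds (x := ‖γ 0 - μs‖ ^ 2 / 2).div_atTop tendsto_id)
    refine tendsto_of_tendsto_of_tendsto_of_le_of_le' tendsto_const_nhds hup ?_ ?_
    · filter_upwards [eventually_ge_atTop 0] with t ht using hmins _ (hmem t ht)
    · filter_upwards [eventually_gt_atTop 0] with t ht
      have h1 := hdist μs hμs hmins 0 t le_rfl ht.le
      rw [sub_zero] at h1
      have h2 : e (γ t) - e μs ≤ ‖γ 0 - μs‖ ^ 2 / 2 / t := by
        rw [le_div_iff₀ ht, le_div_iff₀ two_pos]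
        nlinarith [sq_nonneg ‖γ t - μs‖]
      linarith
  have hK : IsCompact (orthant N ∩ Metric.closedBall μs ‖γ 0 - μs‖) :=
    (isCompact_closedBall _ _).inter_left (isClosed_orthant N)
  obtain ⟨μ, hμK, hμ⟩ := hK.exists_mapClusterPt (f := atTop) (u := γ) (by
    rw [le_principal_iff, mem_map]
    filter_upwards [eventually_ge_atTop 0] with t ht
    exact ⟨hmem t ht, by rw [Metric.mem_closedBall, dist_eq_norm]; exact hbdd t ht⟩)
  -- The cluster point is itself a minimizer: the energies along the curve converge to the minimum
  -- and `e` is continuous on the orthant.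
  have hμe : e μ = e μs := by
    have hc : Tendsto e (𝓝[orthant N] μ) (𝓝 (e μ)) := h.continuousOn μ hμK.1
    have hγw : MapClusterPt μ atTop γ := hμ
    by_contra hne
    obtain ⟨U, V, hU, hV, hμU, hsV, hUV⟩ := t2_separation hne
    have h1 : ∀ᶠ t in atTop, e (γ t) ∈ V := hlim (hV.mem_nhds hsV)
    have h2 : {ν | ν ∈ orthant N → e ν ∈ U} ∈ 𝓝 μ :=
      eventually_nhdsWithin_iff.1 (hc (hU.mem_nhds hμU))
    have h3 : ∃ᶠ t in atTop, γ t ∈ {ν | ν ∈ orthant N → e ν ∈ U} := hγw.frequently h2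
    obtain ⟨t, ht1, ht2, ht3⟩ := (h3.and_eventually (h1.and (eventually_ge_atTop 0))).exists
    exact disjoint_left.1 hUV (ht1 (hmem t ht3)) ht2
  have hminμ : ∀ ν ∈ orthant N, e μ ≤ e ν := fun ν hν => hμe ▸ hmins ν hν
  refine ⟨μ, hμK.1, fun ν hν => ?_, ?_⟩
  · change Φ μ ≤ Φ ν
    rw [h.eq_coe _ hμK.1, h.eq_coe _ hν]
    exact_mod_cast hminμ ν hν
  -- Since the distance to the minimizer `μ` never increases, one visit to the `ε`-ball is enough.
  · rw [Metric.tendsto_atTop]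
    intro ε hε
    obtain ⟨s, hs1, hs2⟩ := ((hμ.frequently (Metric.ball_mem_nhds μ hε)).and_eventually
      (eventually_ge_atTop 0)).exists
    refine ⟨s, fun t hst => ?_⟩
    change dist (γ s) μ < ε at hs1
    rw [dist_eq_norm] at hs1
    rw [dist_eq_norm]
    refine lt_of_le_of_lt (le_of_sq_le_sq ?_ (norm_nonneg _)) hs1
    have h1 := hdist μ hμK.1 hminμ s t hs2 hst
    have h2 : 0 ≤ 2 * (t - s) * (e (γ t) - e μ) :=
      mul_nonneg (by linarith) (sub_nonneg.2 (hminμ _ (hmem t (hs2.trans hst))))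
    linarith

end IsOrthantPotential

/-! ### Parametric quadratic maximization. -/

/-- A parametric quadratic maximization problem over a Hilbert space, plus a positive linear term,
yields a potential on the orthant. -/
theorem exists_isOrthantPotential_of_quadratic {N : ℕ} {H : Type*} [NormedAddCommGroup H]
    [InnerProductSpace ℝ H] [CompleteSpace H] (a : Fin N → H →L[ℝ] H →L[ℝ] ℝ)
    (ha_symm : ∀ i p q, a i p q = a i q p) (ha_nonneg : ∀ i p, 0 ≤ a i p p)
    (a₀ : H →L[ℝ] H →L[ℝ] ℝ) (ha₀_symm : ∀ p q, a₀ p q = a₀ q p) (ha₀ : IsCoercive a₀)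
    (ψ : H →L[ℝ] ℝ) (m : Fin N → ℝ) (hm : ∀ i, 0 < m i)
    (Φ : EuclideanSpace ℝ (Fin N) → EReal) (hΦ_top : ∀ μ, μ ∉ orthant N → Φ μ = ⊤)
    (hΦ : ∀ μ ∈ orthant N, ∀ c : ℝ,
      IsGreatest (range fun p => 2 * ψ p - (a₀ p p + ∑ i, μ i * a i p p)) c →
        Φ μ = ((c + ∑ i, μ i * m i : ℝ) : EReal)) :
    ∃ e g, IsOrthantPotential Φ e g := by
  obtain ⟨c, hc, hco⟩ := ha₀
  let A : EuclideanSpace ℝ (Fin N) → H →L[ℝ] H →L[ℝ] ℝ := fun μ => a₀ + ∑ i, μ i • a i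
  have hA : ∀ μ p q, A μ p q = a₀ p q + ∑ i, μ i * a i p q := fun μ p q => by simp [A]
  have hA_symm : ∀ μ p q, A μ p q = A μ q p := fun μ p q => by
    simp only [hA, ha₀_symm p q, ha_symm _ p q]
  have hAc : ∀ μ ∈ orthant N, ∀ p, c * ‖p‖ * ‖p‖ ≤ A μ p p := fun μ hμ p => by
    rw [hA]
    have : 0 ≤ ∑ i, μ i * a i p p :=
      Finset.sum_nonneg fun i _ => mul_nonneg (hμ i) (ha_nonneg i p)
    linarith [hco p]
  have hA_nonneg : ∀ μ ∈ orthant N, ∀ p, 0 ≤ A μ p p := fun μ hμ p =>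
    (by positivity : 0 ≤ c * ‖p‖ * ‖p‖).trans (hAc μ hμ p)
  have hu : ∀ μ, ∃ u, μ ∈ orthant N → ∀ q, A μ u q = ψ q := fun μ => by
    by_cases hμ : μ ∈ orthant N
    · have hcoer : IsCoercive (A μ) := ⟨c, hc, hAc μ hμ⟩
      refine ⟨hcoer.continuousLinearEquivOfBilin.symm ((InnerProductSpace.toDual ℝ H).symm ψ),
        fun _ q => ?_⟩
      rw [← hcoer.continuousLinearEquivOfBilin_apply, ContinuousLinearEquiv.apply_symm_apply,
        InnerProductSpace.toDual_symm_apply]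
    · exact ⟨0, fun h => absurd h hμ⟩
  choose u hu using hu
  -- Completing the square: the deficit is `A μ (p - u μ) (p - u μ) ≥ 0`.
  have hmax : ∀ μ ∈ orthant N, ∀ p, 2 * ψ p - A μ p p ≤ ψ (u μ) := fun μ hμ p => by
    have h1 := hA_nonneg μ hμ (p - u μ)
    simp only [map_sub, sub_apply] at h1
    rw [hA_symm μ p (u μ), hu μ hμ, hu μ hμ] at h1
    linarith
  set R := ‖ψ‖ / c with hR
  have hR0 : 0 ≤ R := by positivity
  have huR : ∀ μ ∈ orthant N, ‖u μ‖ ≤ R := fun μ hμ => by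
    rw [hR, le_div_iff₀ hc]
    rcases (norm_nonneg (u μ)).eq_or_lt with h0 | h0
    · rw [← h0, zero_mul]; exact norm_nonneg _
    · have h1 := hAc μ hμ (u μ)
      rw [hu μ hμ] at h1
      have h2 := (le_abs_self _).trans (ψ.le_opNorm (u μ))
      refine le_of_mul_le_mul_right ?_ h0
      linarith
  have hab : ∀ i p q, |a i p q| ≤ ‖a i‖ * ‖p‖ * ‖q‖ := fun i p q => (a i).le_opNorm₂ p q
  have huL : ∀ μ ∈ orthant N, ∀ ν ∈ orthant N,
      ‖u μ - u ν‖ ≤ (∑ i, ‖a i‖) * R / c * ‖μ - ν‖ := fun μ hμ ν hν => by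
    set w := u μ - u ν with hw
    rcases (norm_nonneg w).eq_or_lt with h0 | h0
    · rw [← h0]; positivity
    have h1 := hAc μ hμ w
    -- Both `u μ` and `u ν` represent `ψ`, so only the change of the form, linear in `μ - ν`,
    -- remains.
    have h2 : A μ w w = -∑ i, (μ i - ν i) * a i (u ν) w := by
      have h3 : A μ w w = A μ (u μ) w - A μ (u ν) w := by
        simp only [hw, map_sub, sub_apply]
        ring
      have h4 : A μ (u ν) w = A ν (u ν) w + ∑ i, (μ i - ν i) * a i (u ν) w := by
        rw [hA, hA, add_assoc, ← Finset.sum_add_distrib]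
        congr 1
        exact Finset.sum_congr rfl fun i _ => by ring
      rw [h3, h4, hu μ hμ, hu ν hν]; ring
    have h5 : -∑ i, (μ i - ν i) * a i (u ν) w ≤ (∑ i, ‖a i‖) * R * ‖μ - ν‖ * ‖w‖ := by
      refine (neg_le_abs _).trans ((Finset.abs_sum_le_sum_abs _ _).trans ?_)
      rw [Finset.sum_mul, Finset.sum_mul, Finset.sum_mul]
      refine Finset.sum_le_sum fun i _ => ?_
      rw [abs_mul]
      calc |μ i - ν i| * |a i (u ν) w| ≤ ‖μ - ν‖ * (‖a i‖ * R * ‖w‖) := by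
            have := abs_apply_le_norm (μ - ν) i
            rw [PiLp.sub_apply] at this
            refine mul_le_mul this ((hab i _ _).trans ?_) (abs_nonneg _) (norm_nonneg _)
            have := huR ν hν
            gcongr
        _ = _ := by ring
    have h6 : c * ‖w‖ ≤ (∑ i, ‖a i‖) * R * ‖μ - ν‖ := by
      refine le_of_mul_le_mul_right ?_ h0
      linarith
    rw [div_mul_eq_mul_div, le_div_iff₀ hc]
    linarith
  let e : EuclideanSpace ℝ (Fin N) → ℝ := fun μ => ψ (u μ) + ∑ i, μ i * m i
  let g : EuclideanSpace ℝ (Fin N) → EuclideanSpace ℝ (Fin N) := fun μ =>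
    WithLp.toLp 2 fun i => m i - a i (u μ) (u μ)
  refine ⟨e, g, ?_, hΦ_top, ?_, ?_, ?_, ?_⟩
  · intro μ hμ
    refine hΦ μ hμ _ ⟨⟨u μ, ?_⟩, ?_⟩
    · change 2 * ψ (u μ) - _ = ψ (u μ)
      rw [← hA, hu μ hμ]; ring
    · rintro _ ⟨p, rfl⟩
      change 2 * ψ p - (a₀ p p + _) ≤ _
      rw [← hA]
      exact hmax μ hμ p
  · intro μ hμ ν hν
    -- Testing the maximum at `ν` with the maximizer for `μ` gives the subgradient inequality.
    have h1 := hmax ν hν (u μ)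
    have h2 : A ν (u μ) (u μ) = ψ (u μ) + ∑ i, (ν i - μ i) * a i (u μ) (u μ) := by
      rw [← hu μ hμ (u μ), hA, hA, add_assoc, ← Finset.sum_add_distrib]
      congr 1
      exact Finset.sum_congr rfl fun i _ => by ring
    have h3 : inner ℝ (g μ) (ν - μ) = ∑ i, ν i * m i - ∑ i, μ i * m i -
        ∑ i, (ν i - μ i) * a i (u μ) (u μ) := by
      rw [inner_eq_sum, ← Finset.sum_sub_distrib, ← Finset.sum_sub_distrib]
      refine Finset.sum_congr rfl fun i _ => ?_
      simp only [g, PiLp.sub_apply]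
      ring
    simp only [e]
    linarith
  · refine ⟨∑ i, (m i + ‖a i‖ * R * R), Finset.sum_nonneg fun i _ => ?_, fun μ hμ => ?_⟩
    · have := (hm i).le
      positivity
    · refine (norm_le_sum_abs _).trans (Finset.sum_le_sum fun i _ => ?_)
      refine (abs_sub (m i) _).trans ?_
      rw [abs_of_pos (hm i)]
      have h1 := hab i (u μ) (u μ)
      have h2 : ‖a i‖ * ‖u μ‖ * ‖u μ‖ ≤ ‖a i‖ * R * R := by
        have := huR μ hμ
        gcongr
      linarith
  · refine ⟨∑ i, ‖a i‖ * (2 * R) * ((∑ i, ‖a i‖) * R / c), by positivity, fun μ hμ ν hν => ?_⟩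
    refine (norm_le_sum_abs _).trans ?_
    rw [Finset.sum_mul]
    refine Finset.sum_le_sum fun i _ => ?_
    have h1 : (g μ - g ν) i = -(a i (u μ - u ν) (u μ) + a i (u ν) (u μ - u ν)) := by
      simp only [g, PiLp.sub_apply, map_sub, sub_apply]
      ring
    rw [h1, abs_neg]
    have h2 := hab i (u μ - u ν) (u μ)
    have h3 := hab i (u ν) (u μ - u ν)
    have h4 := huR μ hμ
    have h5 := huR ν hν
    have h6 := huL μ hμ ν hν
    calc _ ≤ ‖a i‖ * ‖u μ - u ν‖ * ‖u μ‖ + ‖a i‖ * ‖u ν‖ * ‖u μ - u ν‖ :=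
          (abs_add_le _ _).trans (add_le_add h2 h3)
      _ ≤ ‖a i‖ * ‖u μ - u ν‖ * R + ‖a i‖ * R * ‖u μ - u ν‖ := by gcongr
      _ = ‖a i‖ * (2 * R) * ‖u μ - u ν‖ := by ring
      _ ≤ ‖a i‖ * (2 * R) * ((∑ i, ‖a i‖) * R / c * ‖μ - ν‖) := by gcongr
      _ = _ := by ring
  · obtain ⟨c', hc', hcm⟩ : ∃ c' > 0, ∀ i, c' ≤ m i := by
      rcases isEmpty_or_nonempty (Fin N) with hN | hN
      · exact ⟨1, one_pos, fun i => hN.elim i⟩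
      · obtain ⟨i, hi⟩ := Finite.exists_min m
        exact ⟨m i, hm i, hi⟩
    refine ⟨c', hc', fun μ hμ i => ?_⟩
    have h1 : 0 ≤ ψ (u μ) := by rw [← hu μ hμ (u μ)]; exact hA_nonneg μ hμ _
    have h2 : μ i * m i ≤ ∑ i, μ i * m i :=
      Finset.single_le_sum (f := fun i => μ i * m i)
        (fun j _ => mul_nonneg (hμ j) (hm j).le) (Finset.mem_univ i)
    have h3 : c' * μ i ≤ μ i * m i := by
      rw [mul_comm]; exact mul_le_mul_of_nonneg_left (hcm i) (hμ i)
    simp only [e]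
    linarith

/-! ### Geometry of the cube and its triangulations. -/

section Cube

variable (d : ℕ)

theorem isOpen_unitCube : IsOpen (unitCube d) := by
  have : unitCube d = ⋂ k, {x | 0 < x k ∧ x k < 1} := by ext; simp [unitCube]
  rw [this]
  refine isOpen_iInter_of_finite fun k => ?_
  exact (isOpen_Ioo (a := (0 : ℝ)) (b := 1)).preimage (by fun_prop : Continuous fun x : Eucl d => x k)

theorem convex_unitCube : Convex ℝ (unitCube d) := by
  intro x hx y hy a b ha hb hab k
  simp only [PiLp.add_apply, PiLp.smul_apply, smul_eq_mul]
  obtain ⟨hx0, hx1⟩ := hx k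
  obtain ⟨hy0, hy1⟩ := hy k
  rcases ha.eq_or_lt with rfl | ha
  · rw [zero_add] at hab
    subst hab
    constructor <;> linarith
  · constructor
    · have := mul_pos ha hx0
      have := mul_nonneg hb hy0.le
      linarith
    · have h1 : a * x k < a * 1 := mul_lt_mul_of_pos_left hx1 ha
      have h2 : b * y k ≤ b * 1 := mul_le_mul_of_nonneg_left hy1.le hb
      linarith

theorem isCompact_closure_unitCube : IsCompact (closure (unitCube d)) := by
  refine Bornology.IsBounded.isCompact_closure ?_
  rw [isBounded_iff_forall_norm_le]
  refine ⟨∑ _k : Fin d, 1, fun x hx => (norm_le_sum_abs x).trans ?_⟩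
  exact Finset.sum_le_sum fun k _ => abs_le.2 ⟨by linarith [(hx k).1], (hx k).2.le⟩

instance : IsFiniteMeasure (volume.restrict (unitCube d)) :=
  ⟨by
    rw [Measure.restrict_apply_univ]
    exact (measure_mono subset_closure).trans_lt (isCompact_closure_unitCube d).measure_lt_top⟩

theorem volume_ne_top_of_subset {s : Set (Eucl d)} (hs : s ⊆ unitCube d) : volume s ≠ ⊤ :=
  ((measure_mono (hs.trans subset_closure)).trans_lt
    (isCompact_closure_unitCube d).measure_lt_top).ne

end Cube

namespace Triangulation

variable {d N M : ℕ}

section Cells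

variable (T : Triangulation d N)

theorem isCompact_cell (j : Fin N) : IsCompact (T.cell j) :=
  (finite_range _).isCompact_convexHull ℝ

theorem measurableSet_cell (j : Fin N) : MeasurableSet (T.cell j) :=
  (T.isCompact_cell j).isClosed.measurableSet

theorem cell_subset (j : Fin N) : T.cell j ⊆ closure (unitCube d) := by
  rw [← T.cover]; exact subset_iUnion (fun j => convexHull ℝ (range (T.vertex j))) j

theorem interior_cell_nonempty (j : Fin N) : (interior (T.cell j)).Nonempty := by
  rw [cell, interior_convexHull_nonempty_iff_affineSpan_eq_top,
    (T.affineIndependent j).affineSpan_eq_top_iff_card_eq_finrank_add_one]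
  simp

/-- The part of a cell that is interior to both the cell and the cube. -/
def core (j : Fin N) : Set (Eucl d) := interior (T.cell j) ∩ unitCube d

theorem isOpen_core (j : Fin N) : IsOpen (T.core j) := isOpen_interior.inter (isOpen_unitCube d)

theorem core_subset (j : Fin N) : T.core j ⊆ unitCube d := inter_subset_right

theorem core_nonempty (j : Fin N) : (T.core j).Nonempty := by
  obtain ⟨x, hx⟩ := T.interior_cell_nonempty j
  exact mem_closure_iff.1 (T.cell_subset j (interior_subset hx)) _ isOpen_interior hx

theorem volume_core_pos (j : Fin N) : 0 < volume.real (T.core j) :=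
  ENNReal.toReal_pos ((T.isOpen_core j).measure_pos volume (T.core_nonempty j)).ne'
    (volume_ne_top_of_subset d (T.core_subset j))

/-- If interiors overlap, the hull of the common vertices has interior, so these vertices span the
whole space. Affine independence then makes every vertex of the cell a common one. -/
theorem range_subset_of_interior_inter_nonempty {i j : Fin N} (hij : i ≠ j)
    (h : (interior (T.cell i) ∩ interior (T.cell j)).Nonempty) :
    range (T.vertex i) ⊆ range (T.vertex j) := by
  rw [← interior_inter, cell, cell, T.conforming i j hij,
    interior_convexHull_nonempty_iff_affineSpan_eq_top] at h
  rintro _ ⟨k, rfl⟩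
  have h1 : range (T.vertex i) ∩ range (T.vertex j) =
      T.vertex i '' (T.vertex i ⁻¹' range (T.vertex j)) := by
    rw [image_preimage_eq_range_inter]
  have h2 : T.vertex i k ∈ affineSpan ℝ (range (T.vertex i) ∩ range (T.vertex j)) := by
    rw [h]; exact AffineSubspace.mem_top ℝ _ _
  rw [h1, (T.affineIndependent i).mem_affineSpan_iff] at h2
  exact h2

theorem pairwise_disjoint_core : Pairwise (Function.onFun Disjoint T.core) := by
  intro i j hij
  rw [Function.onFun, disjoint_iff_inter_eq_empty, ← not_nonempty_iff_eq_empty]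
  rintro ⟨x, hxi, hxj⟩
  exact T.distinct i j hij (subset_antisymm
    (T.range_subset_of_interior_inter_nonempty hij ⟨x, hxi.1, hxj.1⟩)
    (T.range_subset_of_interior_inter_nonempty hij.symm ⟨x, hxj.1, hxi.1⟩))

/-- The cells cover the cube, and boundaries of convex sets are null. -/
theorem iUnion_core_ae_eq : (⋃ j, T.core j : Set (Eucl d)) =ᵐ[volume] unitCube d := by
  have h0 : ∀ j, volume (frontier (T.cell j)) = 0 := fun j =>
    (convex_convexHull ℝ _).addHaar_frontier volume
  have h1 : ∀ᵐ x : Eucl d, ∀ j, x ∉ frontier (T.cell j) :=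
    ae_all_iff.2 fun j => measure_eq_zero_iff_ae_notMem.1 (h0 j)
  filter_upwards [h1] with x hx
  refine propext ⟨fun h => ?_, fun h => ?_⟩
  · obtain ⟨j, hj⟩ := mem_iUnion.1 h
    exact hj.2
  · have hc : x ∈ closure (unitCube d) := subset_closure h
    rw [← T.cover] at hc
    obtain ⟨j, hj⟩ := mem_iUnion.1 hc
    refine mem_iUnion.2 ⟨j, ?_, h⟩
    by_contra hni
    exact hx j ⟨subset_closure hj, hni⟩

/-- Cellwise evaluation of an integral over the cube. -/
theorem integral_unitCube_eq_sum {h : Eucl d → ℝ} (hh : ∀ j, IntegrableOn h (T.core j)) :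
    ∫ x in unitCube d, h x = ∑ j, ∫ x in T.core j, h x := by
  rw [← setIntegral_congr_set T.iUnion_core_ae_eq]
  exact integral_iUnion_fintype (fun j => (T.isOpen_core j).measurableSet)
    T.pairwise_disjoint_core hh

theorem integrableOn_indicator_cell (i : Fin N) {s : Set (Eucl d)} (hs : s ⊆ unitCube d) :
    IntegrableOn ((T.cell i).indicator fun _ => (1 : ℝ)) s :=
  (integrableOn_const (volume_ne_top_of_subset d hs)).indicator (T.measurableSet_cell i)

theorem integrableOn_pwConst (μ : EuclideanSpace ℝ (Fin N)) {s : Set (Eucl d)}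
    (hs : s ⊆ unitCube d) : IntegrableOn (T.pwConst μ) s :=
  integrable_finsetSum _ fun i _ => (T.integrableOn_indicator_cell i hs).const_mul (μ i)

theorem integral_pwConst (μ : EuclideanSpace ℝ (Fin N)) {s : Set (Eucl d)}
    (hs : s ⊆ unitCube d) :
    ∫ x in s, T.pwConst μ x = ∑ i, μ i * volume.real (s ∩ T.cell i) := by
  simp only [pwConst]
  rw [integral_finsetSum _ fun i _ => (T.integrableOn_indicator_cell i hs).const_mul (μ i)]
  refine Finset.sum_congr rfl fun i _ => ?_
  rw [integral_const_mul, setIntegral_indicator (T.measurableSet_cell i)]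
  simp

theorem volume_unitCube_inter_cell_pos (i : Fin N) : 0 < volume.real (unitCube d ∩ T.cell i) :=
  (T.volume_core_pos i).trans_le (measureReal_mono
    (fun _ hx => ⟨hx.2, interior_subset hx.1⟩) (volume_ne_top_of_subset d inter_subset_left))

end Cells

/-! ### Piecewise affine functions and their cell gradients. -/

section Slope

variable (T : Triangulation d M)

/-- A point of the interior of a cell. -/
def center (j : Fin M) : Eucl d := (T.core_nonempty j).some

theorem center_mem (j : Fin M) : T.center j ∈ T.core j := (T.core_nonempty j).some_mem

/-- The gradient of `u` on the `j`-th cell. -/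
def slope (u : Eucl d → ℝ) (j : Fin M) : Eucl d := gradient u (T.center j)

variable {T} {u : Eucl d → ℝ}

theorem exists_eqOn_cell (hu : u ∈ T.P1) (j : Fin M) :
    ∃ p : Eucl d, (∃ c, ∀ x ∈ T.cell j, u x = inner ℝ p x + c) ∧
      ∀ x ∈ T.core j, HasGradientAt u p x := by
  obtain ⟨a, ha⟩ := hu.2 j
  set A : Eucl d →L[ℝ] ℝ := LinearMap.toContinuousLinearMap a.linear with hA
  set p := (InnerProductSpace.toDual ℝ (Eucl d)).symm A with hp
  have hp1 : ∀ x, inner ℝ p x = a.linear x := fun x => by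
    rw [hp, InnerProductSpace.toDual_symm_apply]; rfl
  have h1 : ∀ x ∈ T.cell j, u x = inner ℝ p x + a 0 := fun x hx => by
    rw [ha hx, hp1, a.decomp]; simp
  refine ⟨p, ⟨a 0, h1⟩, fun x hx => ?_⟩
  rw [hasGradientAt_iff_hasFDerivAt]
  have h2 : HasFDerivAt (fun x => inner ℝ p x + a 0) (InnerProductSpace.toDual ℝ (Eucl d) p) x :=
    ((InnerProductSpace.toDual ℝ (Eucl d) p).hasFDerivAt (x := x)).add_const (a 0)
  refine h2.congr_of_eventuallyEq ?_
  filter_upwards [mem_interior_iff_mem_nhds.1 hx.1] with y hy using h1 y hy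

theorem hasGradientAt_slope (hu : u ∈ T.P1) (j : Fin M) {x : Eucl d} (hx : x ∈ T.core j) :
    HasGradientAt u (T.slope u j) x := by
  obtain ⟨p, -, hp⟩ := exists_eqOn_cell hu j
  rw [slope, (hp _ (T.center_mem j)).gradient]
  exact hp x hx

theorem exists_eq_on_cell_slope (hu : u ∈ T.P1) (j : Fin M) :
    ∃ c, ∀ x ∈ T.cell j, u x = inner ℝ (T.slope u j) x + c := by
  obtain ⟨p, hc, hp⟩ := exists_eqOn_cell hu j
  rwa [slope, (hp _ (T.center_mem j)).gradient]

/-- A continuous piecewise affine function with vanishing gradients is constant. -/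
theorem exists_eq_const_of_slope_eq_zero (hu : u ∈ T.P1) (h0 : ∀ j, T.slope u j = 0) :
    ∃ c, ∀ x ∈ unitCube d, u x = c := by
  choose c hc using fun j => exists_eq_on_cell_slope hu j
  have himg : u '' closure (unitCube d) ⊆ range c := by
    rintro _ ⟨x, hx, rfl⟩
    rw [← T.cover] at hx
    obtain ⟨j, hj⟩ := mem_iUnion.1 hx
    exact ⟨j, by rw [hc j x hj, h0 j, inner_zero_left, zero_add]⟩
  -- The image of the connected cube is a connected subset of a finite set.
  have hsub : (u '' closure (unitCube d)).Subsingleton :=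
    (finite_range c).countable.isTotallyDisconnected _ himg
      ((convex_unitCube d).closure.isPreconnected.image u hu.1)
  rcases (unitCube d).eq_empty_or_nonempty with he | ⟨y, hy⟩
  · exact ⟨0, by simp [he]⟩
  · exact ⟨u y, fun x hx => hsub (mem_image_of_mem u (subset_closure hx))
      (mem_image_of_mem u (subset_closure hy))⟩

theorem integrableOn_of_mem_P1 (hu : u ∈ T.P1) : IntegrableOn u (unitCube d) :=
  (hu.1.integrableOn_compact (isCompact_closure_unitCube d)).mono_set subset_closure

theorem integrableOn_mul_of_mem_P1 {f : Eucl d → ℝ}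
    (hf : MemLp f ⊤ (volume.restrict (unitCube d))) (hu : u ∈ T.P1) :
    IntegrableOn (fun x => f x * u x) (unitCube d) :=
  hf.integrable_mul (q := 1) (memLp_one_iff_integrable.2 (integrableOn_of_mem_P1 hu))

theorem add_mem_P1 {v : Eucl d → ℝ} (hu : u ∈ T.P1) (hv : v ∈ T.P1) : u + v ∈ T.P1 := by
  refine ⟨hu.1.add hv.1, fun j => ?_⟩
  obtain ⟨a, ha⟩ := hu.2 j
  obtain ⟨b, hb⟩ := hv.2 j
  exact ⟨a + b, fun x hx => by simp [ha hx, hb hx]⟩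

theorem smul_mem_P1 (r : ℝ) (hu : u ∈ T.P1) : r • u ∈ T.P1 := by
  refine ⟨hu.1.const_smul r, fun j => ?_⟩
  obtain ⟨a, ha⟩ := hu.2 j
  exact ⟨r • a, fun x hx => by simp [ha hx]⟩

variable (T)

/-- The mean zero `P₁` functions as a vector space. -/
def meanZeroSubmodule : Submodule ℝ (Eucl d → ℝ) where
  carrier := T.meanZeroP1
  zero_mem' := ⟨⟨continuousOn_const, fun _ => ⟨0, fun _ _ => rfl⟩⟩, by simp⟩
  add_mem' {u v} hu hv := ⟨add_mem_P1 hu.1 hv.1, by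
    simp only [Pi.add_apply]
    rw [integral_add (integrableOn_of_mem_P1 hu.1) (integrableOn_of_mem_P1 hv.1), hu.2, hv.2,
      add_zero]⟩
  smul_mem' r u hu := ⟨smul_mem_P1 r hu.1, by
    simp only [Pi.smul_apply, smul_eq_mul]
    rw [integral_const_mul, hu.2, mul_zero]⟩

/-- The vector of all cell gradients. -/
def slopeMap : T.meanZeroSubmodule →ₗ[ℝ] PiLp 2 (fun _ : Fin M => Eucl d) where
  toFun u := WithLp.toLp 2 (T.slope u)
  map_add' u v := by
    ext1 j
    refine HasGradientAt.gradient (hasGradientAt_iff_hasFDerivAt.2 ?_)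
    simp only [PiLp.add_apply, map_add]
    exact (hasGradientAt_iff_hasFDerivAt.1 (hasGradientAt_slope u.2.1 j (T.center_mem j))).add
      (hasGradientAt_iff_hasFDerivAt.1 (hasGradientAt_slope v.2.1 j (T.center_mem j)))
  map_smul' r u := by
    ext1 j
    refine HasGradientAt.gradient (hasGradientAt_iff_hasFDerivAt.2 ?_)
    simp only [PiLp.smul_apply, RingHom.id_apply, map_smul]
    simpa using (hasGradientAt_iff_hasFDerivAt.1
      (hasGradientAt_slope u.2.1 j (T.center_mem j))).const_smul r

/-- Integration against `f`. -/
def loadMap {f : Eucl d → ℝ} (hf : MemLp f ⊤ (volume.restrict (unitCube d))) :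
    T.meanZeroSubmodule →ₗ[ℝ] ℝ where
  toFun u := ∫ x in unitCube d, f x * u.1 x
  map_add' u v := by
    simp only [Submodule.coe_add, Pi.add_apply, mul_add]
    exact integral_add (integrableOn_mul_of_mem_P1 hf u.2.1) (integrableOn_mul_of_mem_P1 hf v.2.1)
  map_smul' r u := by
    simp only [Submodule.coe_smul, Pi.smul_apply, smul_eq_mul, RingHom.id_apply]
    rw [← integral_const_mul]
    exact integral_congr_ae (ae_of_all _ fun x => by ring)

/-- The load is a functional of the gradients. -/
theorem exists_load_eq {f : Eucl d → ℝ} (hf : MemLp f ⊤ (volume.restrict (unitCube d)))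
    (hf_mean : ∫ x in unitCube d, f x = 0) :
    ∃ ψ : PiLp 2 (fun _ : Fin M => Eucl d) →ₗ[ℝ] ℝ,
      ∀ u : T.meanZeroSubmodule, ψ (T.slopeMap u) = ∫ x in unitCube d, f x * u.1 x := by
  -- A functional vanishing on the kernel of a linear map factors through that map. Here the kernel
  -- consists of functions constant on the cube, which `f` annihilates.
  have hker : T.loadMap hf ∈ (LinearMap.ker T.slopeMap).dualAnnihilator := by
    rw [Submodule.mem_dualAnnihilator]
    intro u hu
    rw [LinearMap.mem_ker] at hu
    obtain ⟨c, hc⟩ := exists_eq_const_of_slope_eq_zero u.2.1 fun j =>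
      congrFun (congrArg WithLp.ofLp hu) j
    change ∫ x in unitCube d, f x * u.1 x = 0
    rw [setIntegral_congr_fun (g := fun x => f x * c) (isOpen_unitCube d).measurableSet
      fun x hx => by simp only [hc x hx], integral_mul_const, hf_mean, zero_mul]
  rw [← LinearMap.range_dualMap_eq_dualAnnihilator_ker] at hker
  obtain ⟨ψ, hψ⟩ := hker
  exact ⟨ψ, fun u => LinearMap.congr_fun hψ u⟩

end Slope

/-- The dual functional in terms of cell gradients. -/
theorem dualFunctional_eq (T : Triangulation d N) (T' : Triangulation d M) (f : Eucl d → ℝ)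
    (δ : ℝ) (μ : EuclideanSpace ℝ (Fin N)) {u : Eucl d → ℝ} (hu : u ∈ T'.P1) :
    dualFunctional f δ (T.pwConst μ) u = 2 * (∫ x in unitCube d, f x * u x) -
      ∑ j, (∑ i, μ i * volume.real (T'.core j ∩ T.cell i) + δ * volume.real (T'.core j)) *
        ‖T'.slope u j‖ ^ 2 := by
  have hi : ∀ j, IntegrableOn (fun x => T.pwConst μ x + δ) (T'.core j) := fun j =>
    (T.integrableOn_pwConst μ (T'.core_subset j)).add
      (integrableOn_const (volume_ne_top_of_subset d (T'.core_subset j)))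
  have hcongr : ∀ j, EqOn (fun x => (T.pwConst μ x + δ) * ‖gradient u x‖ ^ 2)
      (fun x => (T.pwConst μ x + δ) * ‖T'.slope u j‖ ^ 2) (T'.core j) := fun j x hx => by
    simp only [(hasGradientAt_slope hu j hx).gradient]
  have hm : ∀ j, MeasurableSet (T'.core j) := fun j => (T'.isOpen_core j).measurableSet
  rw [dualFunctional, T'.integral_unitCube_eq_sum fun j =>
    (integrableOn_congr_fun (hcongr j) (hm j)).2 ((hi j).mul_const _)]
  congr 1
  refine Finset.sum_congr rfl fun j _ => ?_
  rw [setIntegral_congr_fun (hm j) (hcongr j), integral_mul_const,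
    integral_add (T.integrableOn_pwConst μ (T'.core_subset j))
      (integrableOn_const (volume_ne_top_of_subset d (T'.core_subset j))),
    T.integral_pwConst μ (T'.core_subset j), setIntegral_const, smul_eq_mul, mul_comm δ]

end Triangulation

/-! ### The discrete energy as a quadratic maximum. -/

/-- Linear functionals on finite-dimensional normed spaces are continuous. (This form spares the
unifier from looking through the topology of `PiLp`.) -/
theorem continuous_linearMap_of_normed {E : Type*} [NormedAddCommGroup E] [NormedSpace ℝ E]
    [FiniteDimensional ℝ E] (ψ : E →ₗ[ℝ] ℝ) : Continuous ψ :=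
  ψ.continuous_of_finiteDimensional

/-- The weighted inner product `∑ j, w j ⟪p j, q j⟫`. -/
def weightedInner {d M : ℕ} (w : Fin M → ℝ) :
    PiLp 2 (fun _ : Fin M => Eucl d) →L[ℝ] PiLp 2 (fun _ : Fin M => Eucl d) →L[ℝ] ℝ :=
  ∑ j, w j • (innerSL ℝ).bilinearComp (PiLp.proj 2 (fun _ : Fin M => Eucl d) j)
    (PiLp.proj 2 (fun _ : Fin M => Eucl d) j)

theorem weightedInner_apply {d M : ℕ} (w : Fin M → ℝ) (p q : PiLp 2 (fun _ : Fin M => Eucl d)) :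
    weightedInner w p q = ∑ j, w j * inner ℝ (p j) (q j) := by
  simp [weightedInner]

theorem exists_isOrthantPotential_energy {d N M : ℕ} {f : Eucl d → ℝ}
    (hf : MemLp f ⊤ (volume.restrict (unitCube d))) (hf_mean : ∫ x in unitCube d, f x = 0)
    {δ : ℝ} (hδ : 0 < δ) (T : Triangulation d N) (T' : Triangulation d M) :
    ∃ e g, IsOrthantPotential (energy f δ T T') e g := by
  obtain ⟨ψ, hψ⟩ := T'.exists_load_eq hf hf_mean
  let ψc : PiLp 2 (fun _ : Fin M => Eucl d) →L[ℝ] ℝ := ⟨ψ, continuous_linearMap_of_normed ψ⟩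
  -- The maximization runs over attainable gradient vectors only; the regularizing form is coercive
  -- there because every core has positive volume.
  let S := LinearMap.range T'.slopeMap
  let res : (PiLp 2 (fun _ : Fin M => Eucl d) →L[ℝ] PiLp 2 (fun _ : Fin M => Eucl d) →L[ℝ] ℝ) →
      (S →L[ℝ] S →L[ℝ] ℝ) := fun B => B.bilinearComp S.subtypeL S.subtypeL
  have hres : ∀ w (p q : S), res (weightedInner w) p q =
      ∑ j, w j * inner ℝ (p.1 j) (q.1 j) := fun w p q => weightedInner_apply w p.1 q.1
  refine exists_isOrthantPotential_of_quadratic (H := S)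
    (fun i => res (weightedInner fun j => volume.real (T'.core j ∩ T.cell i)))
    (fun i p q => ?_) (fun i p => ?_)
    (res (weightedInner fun j => δ * volume.real (T'.core j))) (fun p q => ?_) ?_
    (ψc.comp S.subtypeL)
    (fun i => volume.real (unitCube d ∩ T.cell i)) T.volume_unitCube_inter_cell_pos
    _ (fun μ hμ => if_neg hμ) (fun μ hμ c hc => ?_)
  · simp only [hres, real_inner_comm]
  · rw [hres]
    exact Finset.sum_nonneg fun j _ => mul_nonneg measureReal_nonneg real_inner_self_nonneg
  · simp only [hres, real_inner_comm]
  · obtain ⟨κ, hκ, hκm⟩ : ∃ κ > 0, ∀ j, κ ≤ δ * volume.real (T'.core j) := by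
      rcases isEmpty_or_nonempty (Fin M) with hM | hM
      · exact ⟨1, one_pos, fun i => hM.elim i⟩
      · obtain ⟨i, hi⟩ := Finite.exists_min fun j => δ * volume.real (T'.core j)
        exact ⟨_, mul_pos hδ (T'.volume_core_pos i), hi⟩
    refine ⟨κ, hκ, fun p => ?_⟩
    rw [hres, mul_assoc, ← pow_two, Submodule.coe_norm, PiLp.norm_sq_eq_of_L2, Finset.mul_sum]
    refine Finset.sum_le_sum fun j _ => ?_
    rw [real_inner_self_eq_norm_sq]
    exact mul_le_mul_of_nonneg_right (hκm j) (sq_nonneg _)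
  · have hD : ∀ u : T'.meanZeroSubmodule, dualFunctional f δ (T.pwConst μ) u =
        2 * ψ (T'.slopeMap u) -
          (res (weightedInner fun j => δ * volume.real (T'.core j))
            ⟨_, LinearMap.mem_range_self T'.slopeMap u⟩
            ⟨_, LinearMap.mem_range_self T'.slopeMap u⟩ +
          ∑ i, μ i * res (weightedInner fun j => volume.real (T'.core j ∩ T.cell i))
            ⟨_, LinearMap.mem_range_self T'.slopeMap u⟩
            ⟨_, LinearMap.mem_range_self T'.slopeMap u⟩) := fun u => by
      rw [T.dualFunctional_eq T' f δ μ u.2.1, hψ]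
      congr 1
      simp only [hres, real_inner_self_eq_norm_sq, Finset.mul_sum]
      rw [Finset.sum_comm, ← Finset.sum_add_distrib]
      refine Finset.sum_congr rfl fun j _ => ?_
      change _ = δ * volume.real (T'.core j) * ‖T'.slope u j‖ ^ 2 +
        ∑ i, μ i * (volume.real (T'.core j ∩ T.cell i) * ‖T'.slope u j‖ ^ 2)
      rw [add_mul, Finset.sum_mul, add_comm]
      simp only [mul_assoc]
    -- Each element of `S` is the slope vector of some potential, so the maximum over `S` and the
    -- supremum over potentials coincide.
    have hsup : (⨆ u ∈ T'.meanZeroP1, ((dualFunctional f δ (T.pwConst μ) u : ℝ) : EReal)) = c := by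
      refine le_antisymm (iSup₂_le fun u hu => ?_) ?_
      · refine EReal.coe_le_coe (hc.2 ⟨⟨_, LinearMap.mem_range_self T'.slopeMap ⟨u, hu⟩⟩, ?_⟩)
        exact (hD ⟨u, hu⟩).symm
      · obtain ⟨⟨_, u, rfl⟩, hu⟩ := hc.1
        have h1 : dualFunctional f δ (T.pwConst μ) u = c := (hD u).trans hu
        rw [← h1]
        exact le_iSup₂ (f := fun u (_ : u ∈ T'.meanZeroP1) =>
          ((dualFunctional f δ (T.pwConst μ) u : ℝ) : EReal)) u.1 u.2
    rw [energy, if_pos hμ, hsup, T.integral_pwConst μ subset_rfl, ← EReal.coe_add]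

end TransportFEM

end

theorem theorem4p1 (d : ℕ) (hd : 1 ≤ d)
    (f : TransportFEM.Eucl d → ℝ)
    (hf_bdd : MemLp f ⊤ (volume.restrict (TransportFEM.unitCube d)))
    (hf_mean : ∫ x in TransportFEM.unitCube d, f x = 0)
    (hf_supp : closure (convexHull ℝ (TransportFEM.essSupport f)) ⊆ TransportFEM.unitCube d)
    (N : ℕ → ℕ) (T : ∀ n, TransportFEM.Triangulation d (N n))
    (hT : ∀ n, (T n).IsRefinement (T (n + 1)))
    (δ : ℕ → ℝ) (hδ_anti : Antitone δ) (hδ_pos : ∀ m, 0 < δ m)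
    (hδ_lim : Tendsto δ atTop (𝓝 0))
    (n : ℕ)
    (E : EuclideanSpace ℝ (Fin (N n)) → EReal)
    (hE : E = TransportFEM.energy f (δ n) (T n) (T (n + 1)))
    (μ₀ : EuclideanSpace ℝ (Fin (N n)))
    (hμ₀ : μ₀ ∈ TransportFEM.orthant (N n))
    (hμ₀' : TransportFEM.minimalSubgradient E μ₀ ≠ 0) :
    ∃ γ : ℝ → EuclideanSpace ℝ (Fin (N n)),
      TransportFEM.IsEnergySolution E μ₀ γ ∧
      TransportFEM.SolvesFlowAE E γ ∧
      (∀ η : ℝ → EuclideanSpace ℝ (Fin (N n)),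
        TransportFEM.IsEnergySolution E μ₀ η → EqOn η γ (Ici 0)) ∧
      (∀ η : ℝ → EuclideanSpace ℝ (Fin (N n)),
        TransportFEM.IsAdmissibleCurve μ₀ η → TransportFEM.SolvesFlowAE E η →
          EqOn η γ (Ici 0)) ∧
      ∃ μ' ∈ TransportFEM.orthant (N n),
        IsMinOn E (TransportFEM.orthant (N n)) μ' ∧ Tendsto γ atTop (𝓝 μ') := by
  obtain ⟨e, g, h⟩ := TransportFEM.exists_isOrthantPotential_energy hf_bdd hf_mean (hδ_pos n)
    (T n) (T (n + 1))
  rw [← hE] at h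
  obtain ⟨γ, hγ, hflow⟩ := h.exists_solution hμ₀
  exact ⟨γ, h.isEnergySolution_of_solvesFlowAE hγ hflow, hflow,
    fun η hη => h.eqOn_of_solvesFlowAE hγ hflow hη.admissible
      (h.solvesFlowAE_of_isEnergySolution hη),
    fun η hη hηf => h.eqOn_of_solvesFlowAE hγ hflow hη hηf, h.exists_tendsto hγ hflow⟩
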